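/- Let $n_1,n_2$ be distinct odd primes with $\gcd(n_1-1,n_2-1)=6$, and let $n=n_1n_2$, $e=(n_1-1)(n_2-1)/6$. Let $g$ be a common primitive root modulo $n_1$ and modulo $n_2$, and let $u$ be an integer with $u\equiv g \pmod{n_1}$ and $u\equiv 1\pmod{n_2}$. For $0\le i\le 5$ let $W_i=\{g^su^i \bmod n: 0\le s\le e-1\}$, and put $P=\{n_1,2n_1,\dots,(n_2-1)n_1\}$, $D_0=W_0\cup W_2\cup W_4$, $D_1=W_1\cup W_3\cup W_5$, $C_1=P\cup D_1\subseteq\mathbb{Z}_n$. Let $\lambda^\infty$ be the binary sequence of period $n$ with $\lambda_i=1$ if $i \bmod n\in C_1$ and $\lambda_i=0$ otherwise (the first class two-prime Whiteman generalized cyclotomic sequence of order 6). Put $\Lambda(x)=\sum_{i\in C_1}x^i$ and $$g_\lambda(x)=\frac{x^n-1}{\gcd(x^n-1,\Lambda(x))}\in \mathrm{GF}(2)[x].$$ Let $L_\lambda$ be the linear span of $\lambda^\infty$, i.e. the least $l\ge 0$ such that there are $c_0,\dots,c_l\in\mathrm{GF}(2)$ with $c_0\ne0$ and $\sum_{i=0}^{l}c_i\lambda_{j-i}=0$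 for all $j\ge l$. Let $C_\lambda$ be the binary cyclic code of length $n$ corresponding to the ideal of $\mathrm{GF}(2)[x]/(x^n-1)$ generated by $g_\lambda(x)$. A code has parameters $[n,k,d]$ if it has length $n$, dimension $k$ and minimum Hamming distance $d$ between distinct codewords. For a primitive $n$th root of unity $\beta$ in an extension field of $\mathrm{GF}(2)$ let $d_j(x)=\prod_{i\in D_j}(x-\beta^i)$ for $j=0,1$. In each of the cases below $g_\lambda(x)$ is the generator polynomial of $C_\lambda$ (the monic divisor of $x^n-1$ generating the corresponding ideal), and the following holds. 1. If $(n_1,n_2)\equiv(13,7)$ or $(1,19)\pmod{24}$, then $g_\lambda(x)=\frac{x^n-1}{x-1}$, $L_\lambda=n-1$, and $C_\lambda$ has parameters $[n,1,n]$. 2. If $(n_1,n_2)\equiv(7,19)$ or $(19,7)\pmod{24}$, then $g_\lambda(x)=\frac{x^n-1}{x^{n_2}-1}$, $L_\lambda=n-n_2$, and $C_\lambda$ has parameters $[n,n_2,n_1]$. 3. If $(n_1,n_2)\equiv(7,13)$ or $(19,1)\pmod{24}$, then $g_\lambda(x)=\frac{(x^n-1)(x-1)}{(x^{n_1}-1)(x^{n_2}-1)}$,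 $L_\lambda=n-(n_1+n_2-1)$, and $C_\lambda$ has parameters $[n,n_1+n_2-1,d]$, where $d$ is its minimum distance. 4. If $(n_1,n_2)\equiv(1,7)$ or $(13,19)\pmod{24}$, then for every $\beta$ as above either $\Lambda(\beta)=0$ and $g_\lambda(x)=\frac{x^n-1}{(x-1)d_0(x)}$, or $\Lambda(\beta)=1$ and $g_\lambda(x)=\frac{x^n-1}{(x-1)d_1(x)}$. Moreover $L_\lambda=n-\frac{(n_1-1)(n_2-1)+2}{2}$, and $C_\lambda$ has parameters $[n,\frac{(n_1-1)(n_2-1)+2}{2},d]$, where $d$ is its minimum distance. 5. If $(n_1,n_2)\equiv(7,7)$ or $(19,19)\pmod{24}$, then for every $\beta$ as above either $\Lambda(\beta)=0$ and $g_\lambda(x)=\frac{x^n-1}{(x^{n_2}-1)d_0(x)}$, or $\Lambda(\beta)=1$ and $g_\lambda(x)=\frac{x^n-1}{(x^{n_2}-1)d_1(x)}$. Moreover $L_\lambda=n-\frac{(n_1+1)(n_2-1)+2}{2}$, and $C_\lambda$ has parameters $[n,\frac{(n_1+1)(n_2-1)+2}{2},d]$, where $d$ is its minimum distance. 6. If $(n_1,n_2)\equiv(7,1)$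 or $(19,13)\pmod{24}$, then for every $\beta$ as above either $\Lambda(\beta)=0$ and $g_\lambda(x)=\frac{(x^n-1)(x-1)}{(x^{n_1}-1)(x^{n_2}-1)d_0(x)}$, or $\Lambda(\beta)=1$ and $g_\lambda(x)=\frac{(x^n-1)(x-1)}{(x^{n_1}-1)(x^{n_2}-1)d_1(x)}$. Moreover $L_\lambda=n-\frac{(n_1+1)(n_2+1)-2}{2}$, and $C_\lambda$ has parameters $[n,\frac{(n_1+1)(n_2+1)-2}{2},d]$, where $d$ is its minimum distance. -/

import Mathlib

open Polynomial

universe v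

noncomputable section

namespace CyclicCodes

/-! ### Linear codes and cyclic codes -/

section Codes

variable {F : Type*} [Field F]

/-- An `[n, k, d]` linear code over `F`: a `k`-dimensional subspace of `F ^ n` whose minimum
Hamming distance between distinct codewords is `d`. -/
def HasParameters [DecidableEq F] {n : ℕ} (C : Submodule F (Fin n → F)) (k d : ℕ) : Prop :=
  Module.finrank F C = k ∧
    IsLeast {w : ℕ | ∃ x ∈ C, ∃ y ∈ C, x ≠ y ∧ hammingDist x y = w} d

/-- The map `(c₀, …, c_{n-1}) ↦ c₀ + c₁ x + ⋯ + c_{n-1} x ^ (n-1)` from `F ^ n` to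
`F[x] / (x ^ n - 1)`. -/
def wordToRing (F : Type*) [Field F] (n : ℕ) :
    (Fin n → F) →ₗ[F] F[X] ⧸ Ideal.span {(X ^ n - 1 : F[X])} :=
  (Ideal.Quotient.mkₐ F (Ideal.span {(X ^ n - 1 : F[X])})).toLinearMap ∘ₗ
    ∑ i : Fin n, (monomial (i : ℕ)) ∘ₗ (LinearMap.proj i)

/-- The cyclic code of length `n` that corresponds to the ideal `⟨g⟩` of `F[x] / (x ^ n - 1)`. -/
def cyclicCode (n : ℕ) (g : F[X]) : Submodule F (Fin n → F) :=
  ((Ideal.span {Ideal.Quotient.mk (Ideal.span {(X ^ n - 1 : F[X])}) g}).restrictScalars F).comap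
    (wordToRing F n)

/-- `g` is the generator polynomial of the code `C` of length `n`: the monic divisor of
`x ^ n - 1` with `C = ⟨g⟩`. -/
def IsGeneratorPolynomial {n : ℕ} (C : Submodule F (Fin n → F)) (g : F[X]) : Prop :=
  g.Monic ∧ g ∣ X ^ n - 1 ∧ C = cyclicCode n g

end Codes

/-! ### Periodic sequences: linear span, generator polynomial -/

section Sequences

variable {F : Type*} [Field F]

/-- `f = c₀ + c₁ x + ⋯ + c_l x ^ l` with `c₀ ≠ 0` satisfies
`c₀ s_j + c₁ s_{j-1} + ⋯ + c_l s_{j-l} = 0` for all `j ≥ l`. -/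
def IsCharacteristicPolynomial (s : ℕ → F) (l : ℕ) (f : F[X]) : Prop :=
  f.coeff 0 ≠ 0 ∧ f.natDegree ≤ l ∧
    ∀ j, l ≤ j → ∑ i ∈ Finset.range (l + 1), f.coeff i * s (j - i) = 0

/-- The linear span (linear complexity) of `s` is `L`: the smallest recurrence length of a
characteristic polynomial of `s`. -/
def HasLinearSpan (s : ℕ → F) (L : ℕ) : Prop :=
  IsLeast {l : ℕ | ∃ f : F[X], IsCharacteristicPolynomial s l f} L

/-- `S(x) = s₀ + s₁ x + ⋯ + s_{n-1} x ^ (n-1)`. -/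
def seqPoly (n : ℕ) (s : ℕ → F) : F[X] :=
  ∑ i ∈ Finset.range n, C (s i) * X ^ i

/-- `(x ^ n - 1) / gcd (x ^ n - 1, S(x))`, made monic. -/
def seqGenerator [DecidableEq F] (n : ℕ) (s : ℕ → F) : F[X] :=
  normalize ((X ^ n - 1) / EuclideanDomain.gcd (X ^ n - 1) (seqPoly n s))

/-- The cyclic code of length `n` defined by the sequence `s` of period `n`. -/
def seqCode [DecidableEq F] (n : ℕ) (s : ℕ → F) : Submodule F (Fin n → F) :=
  cyclicCode n (seqGenerator n s)

end Sequences

/-! ### Whiteman's generalized cyclotomy for two primes `n₁`, `n₂` -/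

/-- `a` is a primitive root modulo `m`. -/
def IsPrimitiveRootMod (a : ℤ) (m : ℕ) : Prop :=
  IsCoprime a (m : ℤ) ∧ orderOf (a : ZMod m) = Nat.totient m

/-- The order `d = gcd (n₁ - 1, n₂ - 1)` of the cyclotomy. -/
def whitemanOrder (n₁ n₂ : ℕ) : ℕ := Nat.gcd (n₁ - 1) (n₂ - 1)

/-- The class `W_i = {g ^ s * u ^ i mod n : 0 ≤ s < e}`, with `n = n₁ n₂` and
`e = (n₁ - 1)(n₂ - 1) / d`. -/
def whitemanClass (n₁ n₂ : ℕ) (g u : ℤ) (i : ℕ) : Finset (ZMod (n₁ * n₂)) :=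
  (Finset.range ((n₁ - 1) * (n₂ - 1) / whitemanOrder n₁ n₂)).image
    fun s => (g : ZMod (n₁ * n₂)) ^ s * (u : ZMod (n₁ * n₂)) ^ i

/-- `D₀ = W₀ ∪ W₂ ∪ ⋯ ∪ W_{d-2}`. -/
def evenClasses (n₁ n₂ : ℕ) (g u : ℤ) : Finset (ZMod (n₁ * n₂)) :=
  (Finset.range (whitemanOrder n₁ n₂ / 2)).biUnion fun i => whitemanClass n₁ n₂ g u (2 * i)

/-- `D₁ = W₁ ∪ W₃ ∪ ⋯ ∪ W_{d-1}`. -/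
def oddClasses (n₁ n₂ : ℕ) (g u : ℤ) : Finset (ZMod (n₁ * n₂)) :=
  (Finset.range (whitemanOrder n₁ n₂ / 2)).biUnion fun i => whitemanClass n₁ n₂ g u (2 * i + 1)

/-- `P = {n₁, 2 n₁, …, (n₂ - 1) n₁}`. -/
def multiplesOfFirst (n₁ n₂ : ℕ) : Finset (ZMod (n₁ * n₂)) :=
  (Finset.Ico 1 n₂).image fun k => ((k * n₁ : ℕ) : ZMod (n₁ * n₂))

/-- The characteristic set `C₁ = P ∪ W₁ ∪ W₃ ∪ ⋯ ∪ W_{d-1}` of the sequence. -/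
def charSet (n₁ n₂ : ℕ) (g u : ℤ) : Finset (ZMod (n₁ * n₂)) :=
  multiplesOfFirst n₁ n₂ ∪ oddClasses n₁ n₂ g u

/-- The binary first class two-prime Whiteman generalized cyclotomic sequence (WGCS-I) `λ` of
period `n₁ n₂`: `λ_i = 1` if `i mod n₁ n₂` lies in `C₁`, and `λ_i = 0` otherwise. -/
def wgcs (n₁ n₂ : ℕ) (g u : ℤ) (i : ℕ) : ZMod 2 :=
  if (i : ZMod (n₁ * n₂)) ∈ charSet n₁ n₂ g u then 1 else 0

/-- The generator polynomial `g_λ(x) = (x ^ n - 1) / gcd (x ^ n - 1, Λ(x))` over `GF(2)`. -/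
def gLam (n₁ n₂ : ℕ) (g u : ℤ) : (ZMod 2)[X] :=
  seqGenerator (n₁ * n₂) (wgcs n₁ n₂ g u)

/-- The binary cyclic code `C_λ` of length `n₁ n₂` defined by the sequence `λ`. -/
def codeLam (n₁ n₂ : ℕ) (g u : ℤ) : Submodule (ZMod 2) (Fin (n₁ * n₂) → ZMod 2) :=
  seqCode (n₁ * n₂) (wgcs n₁ n₂ g u)

section Extension

variable {K : Type*} [Field K]

/-- `Λ(β) = ∑_{i ∈ C₁} β ^ i`. -/
def lamEval (n₁ n₂ : ℕ) (g u : ℤ) (β : K) : K :=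
  ∑ i ∈ charSet n₁ n₂ g u, β ^ i.val

/-- `d₀(x) = ∏_{i ∈ D₀} (x - β ^ i)`. -/
def d₀ (n₁ n₂ : ℕ) (g u : ℤ) (β : K) : K[X] :=
  ∏ i ∈ evenClasses n₁ n₂ g u, (X - C (β ^ i.val))

/-- `d₁(x) = ∏_{i ∈ D₁} (x - β ^ i)`. -/
def d₁ (n₁ n₂ : ℕ) (g u : ℤ) (β : K) : K[X] :=
  ∏ i ∈ oddClasses n₁ n₂ g u, (X - C (β ^ i.val))

end Extension

end CyclicCodes

end

noncomputable section

namespace CyclicCodes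

/-! ### Linear span of a periodic sequence and the polynomial `seqGenerator`. -/

section Sequences

variable {F : Type*} [Field F]

/-! The linear span is the degree of `g_λ`, the code has dimension `n - deg g_λ`, and `(x^n - 1) /
g_λ` is the product of `x - β^k` over the `k` in `ZMod n` with `Λ(β^k) = 0`. So everything reduces
to locating the zeros of `Λ` among the `n`-th roots of unity.

Let `χ` be the product of the quadratic characters modulo `n₁` and `n₂` (`whitemanChar`). Since
`χ(g) = 1` and `χ(u) = -1`, and the six classes exhaust the units, `D₀` and `D₁` are the fibres of
`χ` over `1` and `-1` (`evenClasses_eq`, `oddClasses_eq`).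

At non-units, counting residues gives `Λ(1) = 0`. For the other multiples `k` of `n₁`, `Λ(β^k) = 0`
iff `n₁ % 4 = 3`; for those of `n₂`, iff `n₂ % 4 = 1`. This yields the factors `x - 1`, `x^n₂ - 1`
and `(x^n₁ - 1)(x^n₂ - 1)/(x - 1)`.

At units, `Λ(β^k)` is `Λ(β)` or `Λ(β) + 1` according as `χ(k)` is `1` or `-1`, because the powers of
`β` with unit exponent sum to `1`. Frobenius gives `Λ(β)^2 = Λ(β^2)`, and `χ(2)` is known from `n₁`,
`n₂` modulo 8. If `χ(2) = 1`, then `Λ(β)` is `0` or `1` and the unit zeros are exactly `D₀` or `D₁`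
(`unitFactor_eq`); if `χ(2) = -1`, then `Λ(β)^2 = Λ(β) + 1` and there are none
(`unitFactor_eq_one`). -/

theorem X_pow_sub_one_ne_zero' {n : ℕ} (hn : 0 < n) : (X ^ n - 1 : F[X]) ≠ 0 := by
  simpa using (monic_X_pow_sub_C (1 : F) hn.ne').ne_zero

theorem natDegree_X_pow_sub_one' (n : ℕ) : (X ^ n - 1 : F[X]).natDegree = n := by
  simpa using natDegree_X_pow_sub_C (n := n) (r := (1 : F))

theorem coeff_seqPoly (n : ℕ) (s : ℕ → F) (k : ℕ) :
    (seqPoly n s).coeff k = if k < n then s k else 0 := by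
  simp [seqPoly, finsetSum_coeff, coeff_C_mul, coeff_X_pow]

theorem natDegree_seqPoly_lt {n : ℕ} (hn : 0 < n) (s : ℕ → F) : (seqPoly n s).natDegree < n := by
  by_contra! h
  have h0 : seqPoly n s ≠ 0 := by
    rintro h0
    rw [h0] at h
    simp at h
    omega
  have := coeff_seqPoly n s (seqPoly n s).natDegree
  rw [if_neg (by omega)] at this
  exact h0 (leadingCoeff_eq_zero.1 this)

/-- The generating function of an `n`-periodic sequence is `S(x) / (1 - x ^ n)`. -/
theorem one_sub_X_pow_mul_mk {n : ℕ} {s : ℕ → F} (hs : ∀ i, s (i + n) = s i) :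
    (1 - PowerSeries.X ^ n) * PowerSeries.mk s = (seqPoly n s : PowerSeries F) := by
  ext k
  rw [sub_mul, one_mul, map_sub, PowerSeries.coeff_X_pow_mul', coeff_coe, coeff_seqPoly]
  by_cases h : n ≤ k
  · rw [if_pos h, if_neg (by omega)]
    have := hs (k - n)
    rw [Nat.sub_add_cancel h] at this
    simp [this]
  · rw [if_neg h, if_pos (by omega)]
    simp

theorem sum_range_eq_coeff_mul {s : ℕ → F} {l j : ℕ} {f : F[X]} (hf : f.natDegree ≤ l)
    (hj : l ≤ j) : ∑ i ∈ Finset.range (l + 1), f.coeff i * s (j - i) =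
      PowerSeries.coeff j ((f : PowerSeries F) * PowerSeries.mk s) := by
  rw [PowerSeries.coeff_mul, Finset.Nat.sum_antidiagonal_eq_sum_range_succ_mk]
  simp only [coeff_coe, PowerSeries.coeff_mk]
  refine Finset.sum_subset (Finset.range_mono (by omega)) fun i _ hi => ?_
  rw [coeff_eq_zero_of_natDegree_lt (by simp at hi; omega), zero_mul]

/-- The characteristic polynomials of an `n`-periodic sequence are the polynomials `f` with
`f(0) ≠ 0` and `x ^ n - 1 ∣ f(x) S(x)`. -/
theorem isCharacteristicPolynomial_iff {n : ℕ} (hn : 0 < n) {s : ℕ → F}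
    (hs : ∀ i, s (i + n) = s i) (l : ℕ) (f : F[X]) :
    IsCharacteristicPolynomial s l f ↔
      f.coeff 0 ≠ 0 ∧ f.natDegree ≤ l ∧ X ^ n - 1 ∣ f * seqPoly n s := by
  refine and_congr_right fun h0 => and_congr_right fun hl => ?_
  have key : ((f * seqPoly n s : F[X]) : PowerSeries F) =
      (1 - PowerSeries.X ^ n) * ((f : PowerSeries F) * PowerSeries.mk s) := by
    rw [Polynomial.coe_mul, ← one_sub_X_pow_mul_mk hs]
    ring
  constructor
  · intro h
    -- The recurrence kills every coefficient from degree `l` on, so the series is a polynomial.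
    have hp : (PowerSeries.trunc l ((f : PowerSeries F) * PowerSeries.mk s) : PowerSeries F) =
        (f : PowerSeries F) * PowerSeries.mk s := by
      ext j
      rw [coeff_coe, PowerSeries.coeff_trunc]
      split_ifs with hj
      · rfl
      · rw [← sum_range_eq_coeff_mul hl (by omega), h j (by omega)]
    generalize PowerSeries.trunc l ((f : PowerSeries F) * PowerSeries.mk s) = p at hp
    refine ⟨-p, ?_⟩
    apply Polynomial.coe_injective F
    rw [key, ← hp]
    push_cast
    ring
  · rintro ⟨q, hq⟩ j hj
    rw [sum_range_eq_coeff_mul hl hj]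
    have hne : (1 - PowerSeries.X ^ n : PowerSeries F) ≠ 0 := by
      intro h
      have := congrArg (PowerSeries.coeff 0) h
      simp [hn.ne'] at this
    -- Cancelling `1 - x^n` turns the series into `-q`. As `deg S < n` and `deg f ≤ l`, `q` has
    -- degree below `l` unless it is zero, so its coefficients at `j ≥ l` vanish.
    have h2 : (f : PowerSeries F) * PowerSeries.mk s = ((-q : F[X]) : PowerSeries F) := by
      apply mul_left_cancel₀ hne
      rw [← key, hq]
      push_cast
      ring
    rw [h2, coeff_coe]
    by_cases hq0 : q = 0
    · simp [hq0]
    rw [coeff_neg, neg_eq_zero]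
    apply coeff_eq_zero_of_natDegree_lt
    have h3 := congrArg natDegree hq
    rw [natDegree_mul (X_pow_sub_one_ne_zero' hn) hq0, natDegree_X_pow_sub_one'] at h3
    have h4 : (f * seqPoly n s).natDegree ≤ _ := natDegree_mul_le
    have h5 := natDegree_seqPoly_lt hn s
    omega

variable [DecidableEq F]

theorem gcd_X_pow_sub_one_ne_zero {n : ℕ} (hn : 0 < n) (p : F[X]) :
    EuclideanDomain.gcd (X ^ n - 1) p ≠ 0 := fun h =>
  X_pow_sub_one_ne_zero' (F := F) hn (EuclideanDomain.gcd_eq_zero_iff.1 h).1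

theorem div_gcd_ne_zero {n : ℕ} (hn : 0 < n) (p : F[X]) :
    (X ^ n - 1) / EuclideanDomain.gcd (X ^ n - 1) p ≠ 0 := by
  intro h
  have := EuclideanDomain.mul_div_cancel' (gcd_X_pow_sub_one_ne_zero hn p)
    (EuclideanDomain.gcd_dvd_left (X ^ n - 1) p)
  rw [h, mul_zero] at this
  exact X_pow_sub_one_ne_zero' hn this.symm

theorem associated_seqGenerator (n : ℕ) (s : ℕ → F) :
    Associated (seqGenerator n s)
      ((X ^ n - 1) / EuclideanDomain.gcd (X ^ n - 1) (seqPoly n s)) :=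
  normalize_associated _

theorem monic_seqGenerator {n : ℕ} (hn : 0 < n) (s : ℕ → F) : (seqGenerator n s).Monic :=
  monic_normalize (div_gcd_ne_zero hn _)

theorem associated_seqGenerator_mul_gcd {n : ℕ} (hn : 0 < n) (s : ℕ → F) :
    Associated (seqGenerator n s * EuclideanDomain.gcd (X ^ n - 1) (seqPoly n s)) (X ^ n - 1) := by
  have := (associated_seqGenerator n s).mul_right
    (EuclideanDomain.gcd (X ^ n - 1) (seqPoly n s))
  rwa [mul_comm (_ / _), EuclideanDomain.mul_div_cancel' (gcd_X_pow_sub_one_ne_zero hn _)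
    (EuclideanDomain.gcd_dvd_left _ _)] at this

theorem seqGenerator_dvd {n : ℕ} (hn : 0 < n) (s : ℕ → F) : seqGenerator n s ∣ X ^ n - 1 :=
  (dvd_mul_right _ _).trans (associated_seqGenerator_mul_gcd hn s).dvd

theorem isGeneratorPolynomial_seqGenerator {n : ℕ} (hn : 0 < n) (s : ℕ → F) :
    IsGeneratorPolynomial (seqCode n s) (seqGenerator n s) :=
  ⟨monic_seqGenerator hn s, seqGenerator_dvd hn s, rfl⟩

/-- By Bézout, `f * gcd` is a combination of `f * (x^n - 1)` and `f * S`; the gcd is then cancelled.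
This makes `seqGenerator` the minimal characteristic polynomial. -/
theorem X_pow_sub_one_dvd_mul_seqPoly_iff {n : ℕ} (hn : 0 < n) (s : ℕ → F) (f : F[X]) :
    X ^ n - 1 ∣ f * seqPoly n s ↔ seqGenerator n s ∣ f := by
  set G := EuclideanDomain.gcd (X ^ n - 1) (seqPoly n s) with hG
  have hG0 : G ≠ 0 := gcd_X_pow_sub_one_ne_zero hn _
  rw [← (associated_seqGenerator_mul_gcd hn s).dvd_iff_dvd_left, ← hG]
  constructor
  · intro h
    have h1 : seqGenerator n s * G ∣ f * G := by
      have hab := EuclideanDomain.gcd_eq_gcd_ab (X ^ n - 1) (seqPoly n s)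
      rw [← hG] at hab
      have hsplit : f * G = f * ((X ^ n - 1) * EuclideanDomain.gcdA (X ^ n - 1) (seqPoly n s)) +
          f * (seqPoly n s * EuclideanDomain.gcdB (X ^ n - 1) (seqPoly n s)) := by
        rw [← mul_add, ← hab]
      rw [hsplit]
      refine dvd_add ?_ ?_
      · exact ((associated_seqGenerator_mul_gcd hn s).dvd.trans (dvd_mul_right _ _)).mul_left _
      · rw [← mul_assoc]
        exact h.mul_right _
    exact (mul_dvd_mul_iff_right hG0).1 h1
  · exact fun h => mul_dvd_mul h (EuclideanDomain.gcd_dvd_right _ _)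

theorem hasLinearSpan_natDegree_seqGenerator {n : ℕ} (hn : 0 < n) {s : ℕ → F}
    (hs : ∀ i, s (i + n) = s i) : HasLinearSpan s (seqGenerator n s).natDegree := by
  constructor
  · refine ⟨seqGenerator n s, (isCharacteristicPolynomial_iff hn hs _ _).2 ⟨?_, le_rfl,
      (X_pow_sub_one_dvd_mul_seqPoly_iff hn s _).2 dvd_rfl⟩⟩
    -- A zero constant term would make `X` a divisor of `x^n - 1`.
    intro h
    have h1 : (X : F[X]) ∣ X ^ n - 1 := (X_dvd_iff.2 h).trans (seqGenerator_dvd hn s)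
    rw [X_dvd_iff] at h1
    simp [coeff_X_pow, hn.ne] at h1
  · rintro l ⟨f, hf⟩
    obtain ⟨h0, hl, h⟩ := (isCharacteristicPolynomial_iff hn hs _ _).1 hf
    refine le_trans (natDegree_le_of_dvd ((X_pow_sub_one_dvd_mul_seqPoly_iff hn s _).1 h) ?_) hl
    rintro rfl
    simp at h0

end Sequences

/-! ### Dimension and minimum distance of cyclic codes. -/

section Codes

variable {F : Type*} [Field F]

/-- The polynomial `c₀ + c₁ x + ⋯ + c_{n-1} x ^ (n-1)` of a word. -/
def wordPoly (F : Type*) [Field F] (n : ℕ) : (Fin n → F) →ₗ[F] F[X] :=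
  ∑ i : Fin n, (monomial (i : ℕ)) ∘ₗ (LinearMap.proj i)

theorem wordPoly_apply (n : ℕ) (c : Fin n → F) :
    wordPoly F n c = ∑ i : Fin n, monomial (i : ℕ) (c i) := by
  simp [wordPoly]

theorem coeff_wordPoly (n : ℕ) (c : Fin n → F) (i : Fin n) : (wordPoly F n c).coeff i = c i := by
  simp [wordPoly_apply, finsetSum_coeff, coeff_monomial, Fin.val_inj]

theorem exists_wordPoly_eq {n : ℕ} {p : F[X]} (hp : p.degree < n) :
    ∃ c : Fin n → F, wordPoly F n c = p := by
  refine ⟨fun i => p.coeff i, ?_⟩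
  rw [wordPoly_apply, Fin.sum_univ_eq_sum_range (fun i => monomial i (p.coeff i)) n]
  by_cases h0 : p = 0
  · simp [h0]
  · exact (as_sum_range' p n ((natDegree_lt_iff_degree_lt h0).2 hp)).symm

theorem degree_wordPoly_lt (n : ℕ) (c : Fin n → F) : (wordPoly F n c).degree < n := by
  rw [wordPoly_apply, ← mem_degreeLT]
  exact Submodule.sum_mem _ fun i _ => mem_degreeLT.2
    ((degree_monomial_le _ _).trans_lt (by exact_mod_cast i.2))

theorem mem_cyclicCode {n : ℕ} {g : F[X]} (hg : g ∣ X ^ n - 1) (c : Fin n → F) :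
    c ∈ cyclicCode n g ↔ g ∣ wordPoly F n c := by
  have : wordToRing F n c = Ideal.Quotient.mk _ (wordPoly F n c) := rfl
  rw [cyclicCode, Submodule.mem_comap, Submodule.restrictScalars_mem, this,
    Ideal.mem_span_singleton]
  constructor
  · rintro ⟨q, hq⟩
    obtain ⟨q, rfl⟩ := Ideal.Quotient.mk_surjective q
    rw [← map_mul, Ideal.Quotient.eq, Ideal.mem_span_singleton] at hq
    exact (dvd_iff_dvd_of_dvd_sub (hg.trans hq)).2 (dvd_mul_right _ _)
  · exact fun h => map_dvd _ h

/-- The code is the kernel of `F^n → F[x]/(g)`. This map is onto because remainders modulo `g` have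
degree below `n`, so rank-nullity applies. -/
theorem finrank_cyclicCode {n : ℕ} (hn : 0 < n) {g : F[X]} (hg : g ∣ X ^ n - 1) :
    Module.finrank F (cyclicCode n g) = n - g.natDegree := by
  have hg0 : g ≠ 0 := ne_zero_of_dvd_ne_zero (X_pow_sub_one_ne_zero' hn) hg
  have hdeg : g.natDegree ≤ n := by
    simpa [natDegree_X_pow_sub_one'] using natDegree_le_of_dvd hg (X_pow_sub_one_ne_zero' hn)
  let φ : (Fin n → F) →ₗ[F] F[X] ⧸ Ideal.span {g} :=
    (Ideal.Quotient.mkₐ F (Ideal.span {g})).toLinearMap ∘ₗ wordPoly F n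
  have hφ (c : Fin n → F) : φ c = Ideal.Quotient.mk _ (wordPoly F n c) := rfl
  have hker : φ.ker = cyclicCode n g := by
    ext c
    rw [mem_cyclicCode hg, LinearMap.mem_ker, hφ, Ideal.Quotient.eq_zero_iff_mem,
      Ideal.mem_span_singleton]
  have hsurj : φ.range = ⊤ := by
    rw [LinearMap.range_eq_top]
    intro q
    obtain ⟨p, rfl⟩ := Ideal.Quotient.mk_surjective q
    obtain ⟨c, hc⟩ := exists_wordPoly_eq (n := n) (p := p % g)
      ((EuclideanDomain.mod_lt p hg0).trans_le
        (degree_le_natDegree.trans (by exact_mod_cast hdeg)))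
    refine ⟨c, ?_⟩
    rw [hφ, hc, Ideal.Quotient.eq, Ideal.mem_span_singleton]
    exact ⟨-(p / g), by linear_combination EuclideanDomain.div_add_mod p g⟩
  have h := φ.finrank_range_add_finrank_ker
  rw [hker, hsurj, finrank_top, finrank_quotient_span_eq_natDegree, Module.finrank_fin_fun] at h
  omega

theorem exists_hasParameters_of_finrank_eq [DecidableEq F] {n k : ℕ} {C : Submodule F (Fin n → F)}
    (hC : Module.finrank F C = k) (hk : 0 < k) : ∃ d, HasParameters C k d := by
  have : Nontrivial C := Module.nontrivial_of_finrank_pos (R := F) (by omega)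
  obtain ⟨x, y, hxy⟩ := exists_pair_ne C
  have hne : {w : ℕ | ∃ x ∈ C, ∃ y ∈ C, x ≠ y ∧ hammingDist x y = w}.Nonempty :=
    ⟨_, x, x.2, y, y.2, fun h => hxy (Subtype.ext h), rfl⟩
  exact ⟨_, hC, Nat.sInf_mem hne, fun w hw => Nat.sInf_le hw⟩

/-- The shifts `x^(m j) * a` occupy disjoint blocks of length `m`, so only `j = i / m` contributes.
-/
theorem coeff_geom_sum_mul {m q : ℕ} {a : F[X]} (ha : a.degree < m) {i : ℕ}
    (hi : i < m * q) : ((∑ j ∈ Finset.range q, (X ^ m) ^ j) * a).coeff i = a.coeff (i % m) := by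
  rw [Finset.sum_mul, finsetSum_coeff, Finset.sum_eq_single (i / m)]
  · rw [← pow_mul, coeff_X_pow_mul', if_pos (Nat.mul_div_le i m), Nat.mod_eq_sub]
  · intro j _ hj
    rw [← pow_mul, coeff_X_pow_mul']
    split_ifs with h
    · apply coeff_eq_zero_of_degree_lt
      refine ha.trans_le ?_
      by_contra! hlt
      have hlt : i - m * j < m := by exact_mod_cast hlt
      refine hj (Nat.div_eq_of_lt_le ?_ ?_).symm <;> nlinarith [Nat.sub_add_cancel h]
    · rfl
  · intro h
    exact absurd (Finset.mem_range.2 (Nat.div_lt_of_lt_mul hi)) h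

theorem card_filter_mod_eq {m q r : ℕ} (hr : r < m) :
    (Finset.univ.filter fun i : Fin (m * q) => (i : ℕ) % m = r).card = q := by
  have hinj : Function.Injective fun j : Fin q => (⟨m * j + r, by nlinarith [j.2]⟩ : Fin (m * q)) :=
    fun j j' h => by
      have h' : m * (j : ℕ) + r = m * j' + r := congrArg Fin.val h
      exact Fin.ext (Nat.eq_of_mul_eq_mul_left (by omega) (Nat.add_right_cancel h'))
  refine Eq.trans (congrArg Finset.card ?_)
    ((Finset.card_image_of_injective Finset.univ hinj).trans (Finset.card_fin q))
  ext i
  simp only [Finset.mem_filter, Finset.mem_univ, true_and, Finset.mem_image]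
  constructor
  · intro h
    exact ⟨⟨i / m, Nat.div_lt_of_lt_mul i.2⟩, Fin.ext (by simp [← h, Nat.div_add_mod])⟩
  · rintro ⟨j, rfl⟩
    simp [Nat.mod_eq_of_lt hr]

/-- The code of length `m q` generated by `(x ^ (m q) - 1) / (x ^ m - 1)` consists of the words
that repeat a block of length `m`, so its parameters are `[m q, m, q]`. -/
theorem hasParameters_cyclicCode_of_mul_eq [DecidableEq F] {m q : ℕ} (hm : 0 < m) (hq : 0 < q)
    {g : F[X]} (hg : g * (X ^ m - 1) = X ^ (m * q) - 1) :
    HasParameters (cyclicCode (m * q) g) m q := by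
  have hgs : g = ∑ j ∈ Finset.range q, (X ^ m) ^ j := by
    apply mul_right_cancel₀ (X_pow_sub_one_ne_zero' (F := F) hm)
    rw [hg, geom_sum_mul, pow_mul]
  have hdvd : g ∣ X ^ (m * q) - 1 := ⟨_, hg.symm⟩
  have hn : 0 < m * q := Nat.mul_pos hm hq
  have hg0 : g ≠ 0 := ne_zero_of_dvd_ne_zero (X_pow_sub_one_ne_zero' hn) hdvd
  have hdeg : g.natDegree + m = m * q := by
    have := congrArg natDegree hg
    rwa [natDegree_mul hg0 (X_pow_sub_one_ne_zero' hm), natDegree_X_pow_sub_one',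
      natDegree_X_pow_sub_one'] at this
  have hmem (c : Fin (m * q) → F) (hc : c ∈ cyclicCode (m * q) g) :
      ∃ a : F[X], ∀ i : Fin (m * q), c i = a.coeff (i % m) := by
    obtain ⟨a, ha⟩ := (mem_cyclicCode hdvd c).1 hc
    have had : a.degree < m := by
      by_cases ha0 : a = 0
      · simp [ha0, bot_lt_iff_ne_bot]
      have h1 := degree_wordPoly_lt (m * q) c
      rw [ha, ← natDegree_lt_iff_degree_lt (mul_ne_zero hg0 ha0), natDegree_mul hg0 ha0] at h1
      rw [← natDegree_lt_iff_degree_lt ha0]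
      omega
    exact ⟨a, fun i => by rw [← coeff_wordPoly _ c, ha, hgs, coeff_geom_sum_mul had i.2]⟩
  refine ⟨by rw [finrank_cyclicCode hn hdvd]; omega, ?_, ?_⟩
  -- The word of `g` itself is `1` exactly at the multiples of `m`, so it attains weight `q`.
  · obtain ⟨c, hc⟩ := exists_wordPoly_eq (F := F) (n := m * q) (p := g)
      (by rw [← natDegree_lt_iff_degree_lt hg0]; omega)
    refine ⟨c, (mem_cyclicCode hdvd c).2 hc.symm.dvd, 0, zero_mem _, ?_, ?_⟩
    · rintro rfl
      exact hg0 (by rw [← hc, map_zero])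
    · rw [hammingDist_zero_right, hammingNorm]
      refine Eq.trans (congrArg Finset.card ?_) (card_filter_mod_eq (m := m) (q := q) hm)
      ext i
      have h1 := coeff_geom_sum_mul (F := F) (m := m) (a := 1) (by simpa using hm) i.2
      rw [mul_one, ← hgs, ← hc, coeff_wordPoly, coeff_one] at h1
      simp [h1]
  -- A difference of codewords that is nonzero at `i₀` is nonzero on the whole class of `i₀` modulo
  -- `m`, which has `q` positions.
  · rintro w ⟨x, hx, y, hy, hxy, rfl⟩
    obtain ⟨a, ha⟩ := hmem (x - y) (sub_mem hx hy)
    obtain ⟨i₀, hi₀⟩ := Function.ne_iff.1 hxy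
    refine (card_filter_mod_eq (m := m) (q := q) (Nat.mod_lt i₀ hm)).symm.trans_le ?_
    rw [hammingDist]
    refine Finset.card_le_card fun i hi => ?_
    rw [Finset.mem_filter] at hi ⊢
    refine ⟨hi.1, fun h => hi₀ (sub_eq_zero.1 ?_)⟩
    have h1 : x i - y i = a.coeff (i % m) := ha i
    have h2 : x i₀ - y i₀ = a.coeff (i₀ % m) := ha i₀
    rw [h2, ← hi.2, ← h1, h, sub_self]

end Codes

/-! ### Factorization of divisors of `x^n - 1` over a field with a primitive root of unity. -/

section RootsOfUnity

variable {K : Type*} [Field K]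

theorem pow_val_injective {n : ℕ} [NeZero n] {β : K} (hβ : IsPrimitiveRoot β n) :
    Function.Injective fun k : ZMod n => β ^ k.val := fun k l h =>
  ZMod.val_injective n (hβ.pow_inj (ZMod.val_lt k) (ZMod.val_lt l) h)

theorem pow_val_pow_eq_one {n : ℕ} {β : K} (hβ : IsPrimitiveRoot β n) (k : ZMod n) :
    (β ^ k.val) ^ n = 1 := by
  rw [← pow_mul, mul_comm, pow_mul, hβ.pow_eq_one, one_pow]

theorem pairwise_isCoprime_X_sub_C_pow_val {n : ℕ} [NeZero n] {β : K}
    (hβ : IsPrimitiveRoot β n) :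
    Pairwise (Function.onFun IsCoprime fun k : ZMod n => (X - C (β ^ k.val) : K[X])) :=
  pairwise_coprime_X_sub_C (pow_val_injective hβ)

theorem natDegree_prod_X_sub_C' {ι : Type*} (T : Finset ι) (f : ι → K) :
    (∏ k ∈ T, (X - C (f k))).natDegree = T.card := by
  rw [natDegree_prod_of_monic _ _ fun k _ => monic_X_sub_C _]
  simp

/-- The `β^k` are distinct, so the product divides `q`; the degree bound and monicity force
equality. -/
theorem prod_X_sub_C_pow_val_eq {n : ℕ} [NeZero n] {β : K} (hβ : IsPrimitiveRoot β n)
    {T : Finset (ZMod n)} {q : K[X]} (hq : q.Monic) (hroot : ∀ k ∈ T, q.IsRoot (β ^ k.val))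
    (hdeg : q.natDegree ≤ T.card) : ∏ k ∈ T, (X - C (β ^ k.val)) = q := by
  refine (eq_of_monic_of_dvd_of_natDegree_le (monic_prod_of_monic _ _ fun k _ => monic_X_sub_C _)
    hq ?_ ?_).symm
  · exact Finset.prod_dvd_of_coprime
      (fun k _ l _ h => pairwise_isCoprime_X_sub_C_pow_val hβ h)
      fun k hk => dvd_iff_isRoot.2 (hroot k hk)
  · rwa [natDegree_prod_X_sub_C']

theorem monic_X_pow_sub_one {n : ℕ} (hn : 0 < n) : (X ^ n - 1 : K[X]).Monic := by
  simpa using monic_X_pow_sub_C (1 : K) hn.ne'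

theorem prod_univ_X_sub_C_pow_val {n : ℕ} [NeZero n] {β : K} (hβ : IsPrimitiveRoot β n) :
    ∏ k : ZMod n, (X - C (β ^ k.val)) = X ^ n - 1 := by
  refine prod_X_sub_C_pow_val_eq hβ (monic_X_pow_sub_one (NeZero.pos n)) (fun k _ => ?_) ?_
  · simp [IsRoot, pow_val_pow_eq_one hβ]
  · simp [natDegree_X_pow_sub_one', ZMod.card]

/-- `g_λ(x)` cofactors in `x ^ n - 1` the product over the `n`-th roots of unity at which the
polynomial of the sequence vanishes. -/
theorem map_seqGenerator_mul_prod {F : Type*} [Field F] [DecidableEq F] [Algebra F K] {n : ℕ}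
    [NeZero n] {β : K} (hβ : IsPrimitiveRoot β n) (s : ℕ → F) {Z : Finset (ZMod n)}
    (hZ : ∀ k, k ∈ Z ↔ aeval (β ^ k.val) (seqPoly n s) = 0) :
    (seqGenerator n s).map (algebraMap F K) * ∏ k ∈ Z, (X - C (β ^ k.val)) = X ^ n - 1 := by
  classical
  have hn : 0 < n := NeZero.pos n
  set G := EuclideanDomain.gcd (X ^ n - 1) (seqPoly n s) with hG
  set H := G.map (algebraMap F K) with hH
  have hmap : (X ^ n - 1 : F[X]).map (algebraMap F K) = X ^ n - 1 := by simp
  have hHgcd : H = EuclideanDomain.gcd (X ^ n - 1) ((seqPoly n s).map (algebraMap F K)) := by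
    rw [hH, hG, ← gcd_map, hmap]
  have hroot (k : ZMod n) : H.IsRoot (β ^ k.val) ↔ k ∈ Z := by
    rw [hHgcd, isRoot_gcd_iff_isRoot_left_right, hZ, IsRoot.def, IsRoot.def, eval_map_algebraMap,
      and_iff_right]
    simp [pow_val_pow_eq_one hβ]
  have h1 : ∏ k ∈ Z, (X - C (β ^ k.val)) ∣ H :=
    Finset.prod_dvd_of_coprime (fun k _ l _ h => pairwise_isCoprime_X_sub_C_pow_val hβ h)
      fun k hk => dvd_iff_isRoot.2 ((hroot k).2 hk)
  -- `H` divides the full product over `ZMod n` and is coprime to the linear factors outside `Z`.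
  have h2 : H ∣ ∏ k ∈ Z, (X - C (β ^ k.val)) := by
    have hd : H ∣ X ^ n - 1 := by
      rw [hHgcd]
      exact EuclideanDomain.gcd_dvd_left _ _
    rw [← prod_univ_X_sub_C_pow_val hβ, ← Finset.prod_mul_prod_compl Z] at hd
    refine IsCoprime.dvd_of_dvd_mul_right (IsCoprime.prod_right fun k hk => ?_) hd
    refine ((irreducible_X_sub_C _).coprime_iff_not_dvd.2 fun h => ?_).symm
    exact (Finset.mem_compl.1 hk) ((hroot k).1 (dvd_iff_isRoot.1 h))
  have h3 : Associated ((seqGenerator n s).map (algebraMap F K) * ∏ k ∈ Z, (X - C (β ^ k.val)))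
      (X ^ n - 1) := by
    refine ((associated_of_dvd_dvd h1 h2).mul_left _).trans ?_
    rw [← hmap, hH, ← Polynomial.map_mul]
    exact (associated_seqGenerator_mul_gcd hn s).map (mapRingHom (algebraMap F K))
  exact eq_of_monic_of_associated
    (((monic_seqGenerator hn s).map _).mul (monic_prod_of_monic _ _ fun k _ => monic_X_sub_C _))
    (monic_X_pow_sub_one hn) h3

theorem sum_univ_zmod_eq_sum_range {M : Type*} [AddCommMonoid M] {n : ℕ} [NeZero n]
    (f : ZMod n → M) : ∑ k : ZMod n, f k = ∑ i ∈ Finset.range n, f i := by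
  refine Finset.sum_bij' (fun k _ => k.val) (fun i _ => (i : ZMod n)) ?_ ?_ ?_ ?_ ?_
  · exact fun k _ => Finset.mem_range.2 (ZMod.val_lt k)
  · simp
  · simp
  · exact fun i hi => ZMod.val_cast_of_lt (Finset.mem_range.1 hi)
  · simp

theorem sum_filter_dvd_val {M : Type*} [AddCommMonoid M] {n m q : ℕ} [NeZero n]
    (hn : n = m * q) (f : ℕ → M) :
    ∑ k : ZMod n with m ∣ k.val, f k.val = ∑ j ∈ Finset.range q, f (m * j) := by
  have hm : 0 < m := Nat.pos_of_ne_zero fun h => NeZero.ne n (by simp [hn, h])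
  have hlt {j : ℕ} (hj : j < q) : m * j < n := hn ▸ Nat.mul_lt_mul_of_pos_left hj hm
  refine Finset.sum_bij' (fun k _ => k.val / m) (fun j _ => ((m * j : ℕ) : ZMod n)) ?_ ?_ ?_ ?_ ?_
  · exact fun k _ => Finset.mem_range.2 (Nat.div_lt_of_lt_mul (hn ▸ ZMod.val_lt k))
  · intro j hj
    rw [Finset.mem_filter, ZMod.val_cast_of_lt (hlt (Finset.mem_range.1 hj))]
    simp
  · intro k hk
    rw [Nat.mul_div_cancel' (Finset.mem_filter.1 hk).2, ZMod.natCast_zmod_val]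
  · intro j hj
    rw [ZMod.val_cast_of_lt (hlt (Finset.mem_range.1 hj)), Nat.mul_div_cancel_left _ hm]
  · intro k hk
    rw [Nat.mul_div_cancel' (Finset.mem_filter.1 hk).2]

theorem card_filter_dvd_val {n m q : ℕ} [NeZero n] (hn : n = m * q) :
    (Finset.univ.filter fun k : ZMod n => m ∣ k.val).card = q := by
  have := sum_filter_dvd_val hn (fun _ => 1)
  simpa using this

theorem prod_filter_dvd_val {n m q : ℕ} [NeZero n] (hn : n = m * q) {β : K}
    (hβ : IsPrimitiveRoot β n) :
    ∏ k : ZMod n with m ∣ k.val, (X - C (β ^ k.val)) = X ^ q - 1 := by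
  have hq : 0 < q := Nat.pos_of_ne_zero fun h => NeZero.ne n (by simp [hn, h])
  refine prod_X_sub_C_pow_val_eq hβ (monic_X_pow_sub_one hq) (fun k hk => ?_) ?_
  · obtain ⟨j, hj⟩ := (Finset.mem_filter.1 hk).2
    have : (β ^ k.val) ^ q = 1 := by
      rw [hj, ← pow_mul, mul_right_comm, ← hn, pow_mul, hβ.pow_eq_one, one_pow]
    simp [IsRoot, this]
  · rw [natDegree_X_pow_sub_one', card_filter_dvd_val hn]

theorem geom_sum_eq_zero {γ : K} {q : ℕ} (h : γ ^ q = 1) (h1 : γ ≠ 1) :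
    ∑ j ∈ Finset.range q, γ ^ j = 0 := by
  have := geom_sum_mul γ q
  rw [h, sub_self] at this
  exact (mul_eq_zero.1 this).resolve_right (sub_ne_zero.2 h1)

end RootsOfUnity

/-! ### Counting quadratic residues and non-residues. -/

section QuadraticCharacter

/-- The character sums to zero, so both fibres have equal size; together with `0` they make up all
`p` elements. -/
theorem card_quadraticChar_eq {p : ℕ} [Fact p.Prime] (hp : p ≠ 2) {ε : ℤ} (hε : ε = 1 ∨ ε = -1) :
    (Finset.univ.filter fun a : ZMod p => quadraticChar (ZMod p) a = ε).card = (p - 1) / 2 := by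
  have hsum := quadraticChar_sum_zero (F := ZMod p) (by rwa [ZMod.ringChar_zmod_n])
  have h1 : ∑ a : ZMod p, quadraticChar (ZMod p) a =
      ∑ a : ZMod p, ((if quadraticChar (ZMod p) a = 1 then 1 else 0) -
        (if quadraticChar (ZMod p) a = -1 then 1 else 0) : ℤ) := by
    refine Finset.sum_congr rfl fun a _ => ?_
    by_cases ha : a = 0
    · simp [ha]
    · rcases quadraticChar_dichotomy ha with h | h <;> simp [h]
  have h2 : ∑ a : ZMod p, (1 : ℤ) =
      ∑ a : ZMod p, ((if quadraticChar (ZMod p) a = 1 then 1 else 0) +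
        (if quadraticChar (ZMod p) a = -1 then 1 else 0) + if a = 0 then 1 else 0 : ℤ) := by
    refine Finset.sum_congr rfl fun a _ => ?_
    by_cases ha : a = 0
    · simp [ha]
    · rcases quadraticChar_dichotomy ha with h | h <;> simp [h, ha]
  rw [hsum, Finset.sum_sub_distrib, Finset.sum_boole, Finset.sum_boole] at h1
  rw [Finset.sum_add_distrib, Finset.sum_add_distrib, Finset.sum_boole, Finset.sum_boole] at h2
  simp only [Finset.sum_const, Finset.card_univ, ZMod.card, nsmul_eq_mul, mul_one,
    Finset.sum_ite_eq', Finset.mem_univ, if_true] at h2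
  have := (Fact.out : p.Prime).two_le
  rcases hε with rfl | rfl <;> omega

end QuadraticCharacter

/-! ### The product character on `ZMod (n₁ * n₂)`. -/

section Whiteman

/-- Reduction from `ZMod (n₁ * n₂)` to `ZMod n₁`. -/
def resFst (n₁ n₂ : ℕ) : ZMod (n₁ * n₂) →+* ZMod n₁ := ZMod.castHom (Dvd.intro _ rfl) _

/-- Reduction from `ZMod (n₁ * n₂)` to `ZMod n₂`. -/
def resSnd (n₁ n₂ : ℕ) : ZMod (n₁ * n₂) →+* ZMod n₂ := ZMod.castHom (Dvd.intro_left _ rfl) _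

variable {n₁ n₂ : ℕ} [Fact n₁.Prime] [Fact n₂.Prime]

instance neZero_mul_primes : NeZero (n₁ * n₂) :=
  ⟨mul_ne_zero (Fact.out : n₁.Prime).ne_zero (Fact.out : n₂.Prime).ne_zero⟩

theorem resFst_eq (k : ZMod (n₁ * n₂)) : resFst n₁ n₂ k = (k.val : ZMod n₁) := by
  rw [resFst, ZMod.castHom_apply, ZMod.cast_eq_val]

theorem resSnd_eq (k : ZMod (n₁ * n₂)) : resSnd n₁ n₂ k = (k.val : ZMod n₂) := by
  rw [resSnd, ZMod.castHom_apply, ZMod.cast_eq_val]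

theorem resFst_eq_zero_iff (k : ZMod (n₁ * n₂)) : resFst n₁ n₂ k = 0 ↔ n₁ ∣ k.val := by
  rw [resFst_eq, ZMod.natCast_eq_zero_iff]

theorem resSnd_eq_zero_iff (k : ZMod (n₁ * n₂)) : resSnd n₁ n₂ k = 0 ↔ n₂ ∣ k.val := by
  rw [resSnd_eq, ZMod.natCast_eq_zero_iff]

theorem chineseRemainder_apply (h : n₁.Coprime n₂) (k : ZMod (n₁ * n₂)) :
    ZMod.chineseRemainder h k = (resFst n₁ n₂ k, resSnd n₁ n₂ k) := by
  rw [resFst_eq, resSnd_eq]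
  conv_lhs => rw [← ZMod.natCast_zmod_val k, map_natCast]
  rfl

theorem eq_of_res_eq (h : n₁.Coprime n₂) {k l : ZMod (n₁ * n₂)}
    (h1 : resFst n₁ n₂ k = resFst n₁ n₂ l) (h2 : resSnd n₁ n₂ k = resSnd n₁ n₂ l) : k = l := by
  apply (ZMod.chineseRemainder h).injective
  rw [chineseRemainder_apply, chineseRemainder_apply, h1, h2]

theorem sum_res {M : Type*} [AddCommMonoid M] (h : n₁.Coprime n₂) (f : ZMod n₁ → ZMod n₂ → M) :
    ∑ k : ZMod (n₁ * n₂), f (resFst n₁ n₂ k) (resSnd n₁ n₂ k) = ∑ a, ∑ b, f a b := by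
  rw [← Fintype.sum_prod_type']
  refine Fintype.sum_equiv (ZMod.chineseRemainder h).toEquiv _ _ fun k => ?_
  have := chineseRemainder_apply h k
  simp [this]

/-- The product of the quadratic characters modulo `n₁` and `n₂`. -/
def whitemanChar (n₁ n₂ : ℕ) [Fact n₁.Prime] [Fact n₂.Prime] (k : ZMod (n₁ * n₂)) : ℤ :=
  quadraticChar (ZMod n₁) (resFst n₁ n₂ k) * quadraticChar (ZMod n₂) (resSnd n₁ n₂ k)

theorem whitemanChar_mul (k l : ZMod (n₁ * n₂)) :
    whitemanChar n₁ n₂ (k * l) = whitemanChar n₁ n₂ k * whitemanChar n₁ n₂ l := by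
  simp only [whitemanChar, map_mul]
  ring

theorem whitemanChar_eq_zero_iff (k : ZMod (n₁ * n₂)) :
    whitemanChar n₁ n₂ k = 0 ↔ resFst n₁ n₂ k = 0 ∨ resSnd n₁ n₂ k = 0 := by
  rw [whitemanChar, mul_eq_zero, quadraticChar_eq_zero_iff, quadraticChar_eq_zero_iff]

theorem whitemanChar_eq_one_or_neg_one {k : ZMod (n₁ * n₂)} (h1 : resFst n₁ n₂ k ≠ 0)
    (h2 : resSnd n₁ n₂ k ≠ 0) : whitemanChar n₁ n₂ k = 1 ∨ whitemanChar n₁ n₂ k = -1 := by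
  rw [whitemanChar]
  rcases quadraticChar_dichotomy h1 with h1 | h1 <;>
    rcases quadraticChar_dichotomy h2 with h2 | h2 <;> simp [h1, h2]

theorem ne_zero_of_whitemanChar {k : ZMod (n₁ * n₂)}
    (h : whitemanChar n₁ n₂ k = 1 ∨ whitemanChar n₁ n₂ k = -1) :
    resFst n₁ n₂ k ≠ 0 ∧ resSnd n₁ n₂ k ≠ 0 := by
  rw [← not_or, ← whitemanChar_eq_zero_iff]
  rcases h with h | h <;> simp [h]

/-- For fixed `b ≠ 0` the condition prescribes the quadratic character of `a`, which leaves `(n₁ -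
1) / 2` choices whichever sign is required. -/
theorem sum_sum_quadraticChar_mul {M : Type*} [AddCommMonoid M] (hp : n₁ ≠ 2) {ε : ℤ}
    (hε : ε = 1 ∨ ε = -1) (f : ZMod n₂ → M) :
    ∑ a : ZMod n₁, ∑ b : ZMod n₂,
      (if quadraticChar (ZMod n₁) a * quadraticChar (ZMod n₂) b = ε then f b else 0) =
    ((n₁ - 1) / 2) • ∑ b : ZMod n₂ with b ≠ 0, f b := by
  rw [Finset.sum_comm, Finset.sum_filter, Finset.smul_sum]
  refine Finset.sum_congr rfl fun b _ => ?_
  by_cases hb : b = 0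
  · have : (0 : ℤ) ≠ ε := by rcases hε with rfl | rfl <;> simp
    simp [hb, this]
  rw [if_pos hb, ← Finset.sum_filter, Finset.sum_const]
  congr 1
  rcases quadraticChar_dichotomy hb with h | h
  · simp only [h, mul_one]
    exact card_quadraticChar_eq hp hε
  · rw [← card_quadraticChar_eq hp (ε := -ε) (by rcases hε with rfl | rfl <;> simp)]
    congr 1
    ext a
    simp only [h, Finset.mem_filter, Finset.mem_univ, true_and, mul_neg, mul_one]
    exact neg_eq_iff_eq_neg

theorem sum_filter_whitemanChar_snd {M : Type*} [AddCommMonoid M] (h : n₁.Coprime n₂)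
    (hp : n₁ ≠ 2) {ε : ℤ} (hε : ε = 1 ∨ ε = -1) (f : ZMod n₂ → M) :
    ∑ k : ZMod (n₁ * n₂) with whitemanChar n₁ n₂ k = ε, f (resSnd n₁ n₂ k) =
      ((n₁ - 1) / 2) • ∑ b : ZMod n₂ with b ≠ 0, f b := by
  rw [← sum_sum_quadraticChar_mul hp hε f, Finset.sum_filter]
  exact sum_res h fun a b =>
    if quadraticChar (ZMod n₁) a * quadraticChar (ZMod n₂) b = ε then f b else 0

theorem sum_filter_whitemanChar_fst {M : Type*} [AddCommMonoid M] (h : n₁.Coprime n₂)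
    (hp : n₂ ≠ 2) {ε : ℤ} (hε : ε = 1 ∨ ε = -1) (f : ZMod n₁ → M) :
    ∑ k : ZMod (n₁ * n₂) with whitemanChar n₁ n₂ k = ε, f (resFst n₁ n₂ k) =
      ((n₂ - 1) / 2) • ∑ b : ZMod n₁ with b ≠ 0, f b := by
  rw [← sum_sum_quadraticChar_mul hp hε f, Finset.sum_filter, Finset.sum_comm]
  refine (sum_res h fun a b =>
    if quadraticChar (ZMod n₁) a * quadraticChar (ZMod n₂) b = ε then f a else 0).trans ?_
  simp only [mul_comm]

theorem card_filter_whitemanChar (h : n₁.Coprime n₂) (hp : n₁ ≠ 2) {ε : ℤ}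
    (hε : ε = 1 ∨ ε = -1) :
    (Finset.univ.filter fun k : ZMod (n₁ * n₂) => whitemanChar n₁ n₂ k = ε).card =
      (n₁ - 1) / 2 * (n₂ - 1) := by
  have := sum_filter_whitemanChar_snd h hp hε (fun _ => 1)
  rw [Finset.sum_const, Finset.sum_const, smul_eq_mul, mul_one, smul_eq_mul,
    smul_eq_mul, mul_one, Finset.filter_ne', Finset.card_erase_of_mem (Finset.mem_univ _), Finset.card_univ,
    ZMod.card] at this
  exact this

theorem whitemanChar_two (h1 : n₁ ≠ 2) (h2 : n₂ ≠ 2) :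
    whitemanChar n₁ n₂ 2 = ZMod.χ₈ n₁ * ZMod.χ₈ n₂ := by
  rw [whitemanChar, map_ofNat (resFst n₁ n₂), map_ofNat (resSnd n₁ n₂),
    quadraticChar_two (by rwa [ZMod.ringChar_zmod_n]),
    quadraticChar_two (by rwa [ZMod.ringChar_zmod_n]), ZMod.card, ZMod.card]

/-! ### Whiteman classes as fibres of the product character. -/

section Classes

theorem IsPrimitiveRootMod.isPrimitiveRoot {g : ℤ} {p : ℕ} [Fact p.Prime]
    (hg : IsPrimitiveRootMod g p) : IsPrimitiveRoot (g : ZMod p) (p - 1) := by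
  rw [← Nat.totient_prime (Fact.out : p.Prime), ← hg.2]
  exact IsPrimitiveRoot.orderOf _

theorem IsPrimitiveRootMod.ne_zero {g : ℤ} {p : ℕ} [Fact p.Prime]
    (hg : IsPrimitiveRootMod g p) : (g : ZMod p) ≠ 0 :=
  hg.isPrimitiveRoot.ne_zero (by have := (Fact.out : p.Prime).two_le; omega)

theorem IsPrimitiveRootMod.exists_pow_eq {g : ℤ} {p : ℕ} [Fact p.Prime]
    (hg : IsPrimitiveRootMod g p) {x : ZMod p} (hx : x ≠ 0) : ∃ a : ℕ, (g : ZMod p) ^ a = x := by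
  have : NeZero (p - 1) := ⟨by have := (Fact.out : p.Prime).two_le; omega⟩
  obtain ⟨a, -, ha⟩ := hg.isPrimitiveRoot.eq_pow_of_pow_eq_one (ZMod.pow_card_sub_one_eq_one hx)
  exact ⟨a, ha⟩

theorem IsPrimitiveRootMod.pow_congr {g : ℤ} {p : ℕ} [Fact p.Prime]
    (hg : IsPrimitiveRootMod g p) {a b : ℕ} (h : a ≡ b [MOD p - 1]) :
    (g : ZMod p) ^ a = (g : ZMod p) ^ b := by
  exact pow_eq_pow_of_modEq h hg.isPrimitiveRoot.pow_eq_one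

theorem IsPrimitiveRootMod.quadraticChar_eq {g : ℤ} {p : ℕ} [Fact p.Prime]
    (hg : IsPrimitiveRootMod g p) (hp : p ≠ 2) : quadraticChar (ZMod p) g = -1 := by
  rw [quadraticChar_neg_one_iff_not_isSquare,
    FiniteField.isSquare_iff (by rwa [ZMod.ringChar_zmod_n]) hg.ne_zero, ZMod.card]
  intro h
  have h2 := (Fact.out : p.Prime).two_le
  have := Nat.le_of_dvd (by omega) (hg.isPrimitiveRoot.dvd_of_pow_eq_one _ h)
  omega

variable {g u : ℤ}

theorem whitemanChar_pow_mul_pow (h1 : n₁ ≠ 2) (h2 : n₂ ≠ 2) (hg₁ : IsPrimitiveRootMod g n₁)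
    (hg₂ : IsPrimitiveRootMod g n₂) (hu₁ : u ≡ g [ZMOD n₁]) (hu₂ : u ≡ 1 [ZMOD n₂]) (s i : ℕ) :
    whitemanChar n₁ n₂ ((g : ZMod (n₁ * n₂)) ^ s * (u : ZMod (n₁ * n₂)) ^ i) = (-1) ^ i := by
  have e1 : (u : ZMod n₁) = g := (ZMod.intCast_eq_intCast_iff _ _ _).2 hu₁
  have e2 : (u : ZMod n₂) = 1 := by
    simpa using (ZMod.intCast_eq_intCast_iff _ _ _).2 hu₂
  simp only [whitemanChar, map_mul, map_pow, map_intCast, e1, e2, hg₁.quadraticChar_eq h1,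
    hg₂.quadraticChar_eq h2, one_pow, mul_one]
  rw [mul_right_comm, ← mul_pow]
  simp

theorem exists_mem_whitemanClass (h : n₁.Coprime n₂) (hd : whitemanOrder n₁ n₂ = 6)
    (hg₁ : IsPrimitiveRootMod g n₁) (hg₂ : IsPrimitiveRootMod g n₂) (hu₁ : u ≡ g [ZMOD n₁])
    (hu₂ : u ≡ 1 [ZMOD n₂]) {k : ZMod (n₁ * n₂)} (hk₁ : resFst n₁ n₂ k ≠ 0)
    (hk₂ : resSnd n₁ n₂ k ≠ 0) : ∃ i < 6, k ∈ whitemanClass n₁ n₂ g u i := by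
  have e1 : (u : ZMod n₁) = g := (ZMod.intCast_eq_intCast_iff _ _ _).2 hu₁
  have e2 : (u : ZMod n₂) = 1 := by
    simpa using (ZMod.intCast_eq_intCast_iff _ _ _).2 hu₂
  have p1 := (Fact.out : n₁.Prime).two_le
  have p2 := (Fact.out : n₂.Prime).two_le
  obtain ⟨a, ha⟩ := hg₁.exists_pow_eq hk₁
  obtain ⟨b, hb⟩ := hg₂.exists_pow_eq hk₂
  have hd' : Nat.gcd (n₁ - 1) (n₂ - 1) = 6 := hd
  obtain ⟨m, hm⟩ : 6 ∣ n₁ - 1 := hd' ▸ Nat.gcd_dvd_left _ _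
  obtain ⟨m, rfl⟩ : ∃ m', m = m' + 1 := ⟨m - 1, by omega⟩
  -- Membership in class `i` asks for `s + i ≡ a` modulo `n₁ - 1` and `s ≡ b` modulo `n₂ - 1`,
  -- solvable iff `i ≡ a - b` modulo the gcd `6`; `5 * b` stands for `-b`.
  set i := (a + 5 * b) % 6 with hi
  -- Here `6 * m + 5 = n₁ - 2`, which is `-1` modulo `n₁ - 1`, so the left side represents `a - i`
  -- without subtraction.
  have hmod : a + (6 * m + 5) * i ≡ b [MOD Nat.gcd (n₁ - 1) (n₂ - 1)] := by
    have : (6 * m + 5) * i = 6 * (m * i) + 5 * i := by ring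
    rw [hd', this, Nat.ModEq]
    omega
  obtain ⟨hs1, hs2⟩ := (Nat.chineseRemainder' hmod).2
  -- The range `e = (n₁ - 1)(n₂ - 1) / 6` of exponents is precisely this lcm.
  have hlt := Nat.chineseRemainder'_lt_lcm hmod (by omega) (by omega)
  set s := (Nat.chineseRemainder' hmod : ℕ)
  refine ⟨i, Nat.mod_lt _ (by norm_num), Finset.mem_image.2 ⟨s, ?_, ?_⟩⟩
  · exact Finset.mem_range.2 hlt
  · apply eq_of_res_eq h
    · simp only [map_mul, map_pow, map_intCast, e1]
      rw [← ha, ← pow_add]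
      apply hg₁.pow_congr
      refine (hs1.add_right i).trans ?_
      have : a + (6 * m + 5) * i + i = a + (n₁ - 1) * i := by rw [hm]; ring
      rw [this, Nat.ModEq]
      simp
    · simp only [map_mul, map_pow, map_intCast, e2, one_pow, mul_one]
      rw [← hb]
      exact hg₂.pow_congr hs2

theorem evenClasses_eq (h : n₁.Coprime n₂) (h1 : n₁ ≠ 2) (h2 : n₂ ≠ 2)
    (hd : whitemanOrder n₁ n₂ = 6)
    (hg₁ : IsPrimitiveRootMod g n₁) (hg₂ : IsPrimitiveRootMod g n₂) (hu₁ : u ≡ g [ZMOD n₁])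
    (hu₂ : u ≡ 1 [ZMOD n₂]) :
    evenClasses n₁ n₂ g u = Finset.univ.filter fun k => whitemanChar n₁ n₂ k = 1 := by
  have hW {k : ZMod (n₁ * n₂)} {i : ℕ} (hk : k ∈ whitemanClass n₁ n₂ g u i) :
      whitemanChar n₁ n₂ k = (-1) ^ i := by
    obtain ⟨s, -, rfl⟩ := Finset.mem_image.1 hk
    exact whitemanChar_pow_mul_pow h1 h2 hg₁ hg₂ hu₁ hu₂ s i
  ext k
  rw [evenClasses, hd, Finset.mem_biUnion, Finset.mem_filter]
  constructor
  · rintro ⟨j, -, hk⟩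
    simp [hW hk]
  · rintro ⟨-, hk⟩
    obtain ⟨i, hi, hki⟩ := exists_mem_whitemanClass h hd hg₁ hg₂ hu₁ hu₂
      (ne_zero_of_whitemanChar (Or.inl hk)).1 (ne_zero_of_whitemanChar (Or.inl hk)).2
    rw [hW hki] at hk
    obtain ⟨j, rfl⟩ : Even i := by
      by_contra hodd
      rw [(Nat.not_even_iff_odd.1 hodd).neg_one_pow] at hk
      norm_num at hk
    exact ⟨j, Finset.mem_range.2 (by omega), by rwa [two_mul]⟩

theorem oddClasses_eq (h : n₁.Coprime n₂) (h1 : n₁ ≠ 2) (h2 : n₂ ≠ 2)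
    (hd : whitemanOrder n₁ n₂ = 6)
    (hg₁ : IsPrimitiveRootMod g n₁) (hg₂ : IsPrimitiveRootMod g n₂) (hu₁ : u ≡ g [ZMOD n₁])
    (hu₂ : u ≡ 1 [ZMOD n₂]) :
    oddClasses n₁ n₂ g u = Finset.univ.filter fun k => whitemanChar n₁ n₂ k = -1 := by
  have hW {k : ZMod (n₁ * n₂)} {i : ℕ} (hk : k ∈ whitemanClass n₁ n₂ g u i) :
      whitemanChar n₁ n₂ k = (-1) ^ i := by
    obtain ⟨s, -, rfl⟩ := Finset.mem_image.1 hk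
    exact whitemanChar_pow_mul_pow h1 h2 hg₁ hg₂ hu₁ hu₂ s i
  ext k
  rw [oddClasses, hd, Finset.mem_biUnion, Finset.mem_filter]
  constructor
  · rintro ⟨j, -, hk⟩
    simp [hW hk, pow_succ]
  · rintro ⟨-, hk⟩
    obtain ⟨i, hi, hki⟩ := exists_mem_whitemanClass h hd hg₁ hg₂ hu₁ hu₂
      (ne_zero_of_whitemanChar (Or.inr hk)).1 (ne_zero_of_whitemanChar (Or.inr hk)).2
    rw [hW hki] at hk
    obtain ⟨j, rfl⟩ : Odd i := by
      by_contra heven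
      rw [(Nat.not_odd_iff_even.1 heven).neg_one_pow] at hk
      norm_num at hk
    exact ⟨j, Finset.mem_range.2 (by omega), hki⟩


end Classes

theorem multiplesOfFirst_eq : multiplesOfFirst n₁ n₂ =
    (Finset.univ.filter fun k : ZMod (n₁ * n₂) => n₁ ∣ k.val).erase 0 := by
  have hp : 0 < n₁ := (Fact.out : n₁.Prime).pos
  ext k
  simp only [multiplesOfFirst, Finset.mem_image, Finset.mem_Ico, Finset.mem_erase,
    Finset.mem_filter, Finset.mem_univ, true_and]
  constructor
  · rintro ⟨j, ⟨hj1, hj2⟩, rfl⟩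
    have hv : ((j * n₁ : ℕ) : ZMod (n₁ * n₂)).val = j * n₁ :=
      ZMod.val_cast_of_lt (by nlinarith)
    refine ⟨fun h => ?_, by rw [hv]; exact dvd_mul_left _ _⟩
    rw [h, ZMod.val_zero] at hv
    have := Nat.mul_pos hj1 hp
    omega
  · rintro ⟨h0, j, hj⟩
    refine ⟨j, ⟨Nat.pos_of_ne_zero ?_, ?_⟩, ?_⟩
    · rintro rfl
      rw [mul_zero, ZMod.val_eq_zero] at hj
      exact h0 hj
    · have := ZMod.val_lt k
      rw [hj] at this
      exact Nat.lt_of_mul_lt_mul_left this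
    · have := congrArg (Nat.cast : ℕ → ZMod (n₁ * n₂)) hj
      rwa [ZMod.natCast_zmod_val, mul_comm n₁ j, eq_comm] at this

end Whiteman

/-! ### Values of `Λ` at the `n`-th roots of unity. -/

section Values

theorem lamEval_sq {K : Type*} [Field K] [CharP K 2] (n₁ n₂ : ℕ) (g u : ℤ) (β : K) : lamEval n₁ n₂ g u β ^ 2 = lamEval n₁ n₂ g u (β ^ 2) := by
  rw [lamEval, CharTwo.sum_sq, lamEval]
  exact Finset.sum_congr rfl fun k _ => pow_right_comm _ _ _

/-- Whiteman's setting of order `6` for the distinct odd primes `n₁`, `n₂`. -/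
structure IsWhitemanSetting (n₁ n₂ : ℕ) (g u : ℤ) : Prop where
  ne_two₁ : n₁ ≠ 2
  ne_two₂ : n₂ ≠ 2
  coprime : n₁.Coprime n₂
  order : whitemanOrder n₁ n₂ = 6
  primitive₁ : IsPrimitiveRootMod g n₁
  primitive₂ : IsPrimitiveRootMod g n₂
  modEq₁ : u ≡ g [ZMOD n₁]
  modEq₂ : u ≡ 1 [ZMOD n₂]

variable {n₁ n₂ : ℕ} [Fact n₁.Prime] [Fact n₂.Prime] {g u : ℤ}

theorem IsWhitemanSetting.evenClasses_eq (h : IsWhitemanSetting n₁ n₂ g u) :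
    evenClasses n₁ n₂ g u = Finset.univ.filter fun k => whitemanChar n₁ n₂ k = 1 :=
  CyclicCodes.evenClasses_eq h.coprime h.ne_two₁ h.ne_two₂ h.order h.primitive₁ h.primitive₂
    h.modEq₁ h.modEq₂

theorem IsWhitemanSetting.oddClasses_eq (h : IsWhitemanSetting n₁ n₂ g u) :
    oddClasses n₁ n₂ g u = Finset.univ.filter fun k => whitemanChar n₁ n₂ k = -1 :=
  CyclicCodes.oddClasses_eq h.coprime h.ne_two₁ h.ne_two₂ h.order h.primitive₁ h.primitive₂
    h.modEq₁ h.modEq₂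

theorem coprime_val {k : ZMod (n₁ * n₂)}
    (hk : whitemanChar n₁ n₂ k = 1 ∨ whitemanChar n₁ n₂ k = -1) : k.val.Coprime (n₁ * n₂) := by
  obtain ⟨h1, h2⟩ := ne_zero_of_whitemanChar hk
  rw [Ne, resFst_eq_zero_iff] at h1
  rw [Ne, resSnd_eq_zero_iff] at h2
  exact Nat.Coprime.mul_right (((Fact.out : n₁.Prime).coprime_iff_not_dvd.2 h1).symm)
    (((Fact.out : n₂.Prime).coprime_iff_not_dvd.2 h2).symm)

variable {K : Type*} [Field K]

/-- `∑ γ ^ k` over the `k` with `whitemanChar n₁ n₂ k = ε`. -/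
def charSum (n₁ n₂ : ℕ) [Fact n₁.Prime] [Fact n₂.Prime] (ε : ℤ) (γ : K) : K :=
  ∑ k : ZMod (n₁ * n₂) with whitemanChar n₁ n₂ k = ε, γ ^ k.val

/-- `P` is the set of all multiples of `n₁` with `0` removed, which accounts for the geometric sum
and the `-1`. -/
theorem lamEval_eq (h : IsWhitemanSetting n₁ n₂ g u) (γ : K) :
    lamEval n₁ n₂ g u γ =
      (∑ j ∈ Finset.range n₂, (γ ^ n₁) ^ j) - 1 + charSum n₁ n₂ (-1) γ := by
  have hdisj : Disjoint (multiplesOfFirst n₁ n₂) (oddClasses n₁ n₂ g u) := by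
    rw [multiplesOfFirst_eq, h.oddClasses_eq, Finset.disjoint_left]
    intro k hk hk'
    simp only [Finset.mem_erase, Finset.mem_filter, Finset.mem_univ, true_and] at hk hk'
    exact (ne_zero_of_whitemanChar (Or.inr hk')).1 ((resFst_eq_zero_iff k).2 hk.2)
  rw [lamEval, charSet, Finset.sum_union hdisj, h.oddClasses_eq, charSum, multiplesOfFirst_eq]
  congr 1
  have h0 : (0 : ZMod (n₁ * n₂)) ∈
      Finset.univ.filter fun k : ZMod (n₁ * n₂) => n₁ ∣ k.val := by simp
  have h1 := Finset.sum_erase_add _ (fun k : ZMod (n₁ * n₂) => γ ^ k.val) h0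
  rw [sum_filter_dvd_val (q := n₂) rfl fun i => γ ^ i, ZMod.val_zero, pow_zero] at h1
  simp only [pow_mul] at h1
  exact eq_sub_of_add_eq h1

theorem sum_ne_zero_pow_val {p : ℕ} [Fact p.Prime] {γ : K} (h : γ ^ p = 1) (h1 : γ ≠ 1) :
    ∑ b : ZMod p with b ≠ 0, γ ^ b.val = -1 := by
  have := sum_filter_dvd_val (n := p) (m := 1) (q := p) (one_mul p).symm fun i => γ ^ i
  simp only [one_dvd, Finset.filter_true, one_mul] at this
  rw [geom_sum_eq_zero h h1, ← Finset.sum_erase_add _ _ (Finset.mem_univ (0 : ZMod p)),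
    ZMod.val_zero, pow_zero] at this
  rw [Finset.filter_ne']
  exact eq_neg_of_add_eq_zero_left this

/-- `γ^k` depends only on `k` modulo `n₂`. Each nonzero residue occurs `(n₁ - 1) / 2` times, and the
nontrivial powers of `γ` sum to `-1`. -/
theorem charSum_eq_of_pow_snd (h : IsWhitemanSetting n₁ n₂ g u) {ε : ℤ} (hε : ε = 1 ∨ ε = -1)
    {γ : K} (hγ : γ ^ n₂ = 1) (h1 : γ ≠ 1) :
    charSum n₁ n₂ ε γ = -((n₁ - 1) / 2 : ℕ) := by
  have := sum_filter_whitemanChar_snd h.coprime h.ne_two₁ hε fun b => γ ^ b.val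
  rw [sum_ne_zero_pow_val hγ h1] at this
  rw [charSum, ← mul_neg_one, ← nsmul_eq_mul, ← this]
  refine Finset.sum_congr rfl fun k _ => ?_
  rw [resSnd_eq, ZMod.val_natCast, ← pow_eq_pow_mod _ hγ]

theorem charSum_eq_of_pow_fst (h : IsWhitemanSetting n₁ n₂ g u) {ε : ℤ} (hε : ε = 1 ∨ ε = -1)
    {γ : K} (hγ : γ ^ n₁ = 1) (h1 : γ ≠ 1) :
    charSum n₁ n₂ ε γ = -((n₂ - 1) / 2 : ℕ) := by
  have := sum_filter_whitemanChar_fst h.coprime h.ne_two₂ hε fun b => γ ^ b.val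
  rw [sum_ne_zero_pow_val hγ h1] at this
  rw [charSum, ← mul_neg_one, ← nsmul_eq_mul, ← this]
  refine Finset.sum_congr rfl fun k _ => ?_
  rw [resFst_eq, ZMod.val_natCast, ← pow_eq_pow_mod _ hγ]

theorem pow_val_pow_val {n : ℕ} {β : K} (hβ : β ^ n = 1) (k l : ZMod n) :
    (β ^ k.val) ^ l.val = β ^ (k * l).val := by
  rw [ZMod.val_mul, ← pow_mul, ← pow_eq_pow_mod _ hβ]

/-- Multiplication by the unit `k` permutes `ZMod (n₁ * n₂)` and scales the character by its value
at `k`. -/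
theorem charSum_pow_val (h : IsWhitemanSetting n₁ n₂ g u) {β : K} (hβ : β ^ (n₁ * n₂) = 1)
    {k : ZMod (n₁ * n₂)} (hk : whitemanChar n₁ n₂ k = 1 ∨ whitemanChar n₁ n₂ k = -1) (ε : ℤ) :
    charSum n₁ n₂ ε (β ^ k.val) = charSum n₁ n₂ (whitemanChar n₁ n₂ k * ε) β := by
  have hbij : Function.Bijective fun l : ZMod (n₁ * n₂) => k * l := by
    rw [← Finite.injective_iff_bijective]
    intro l l' hl
    have hl : k * l = k * l' := hl
    obtain ⟨h1, h2⟩ := ne_zero_of_whitemanChar hk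
    apply eq_of_res_eq h.coprime
    · exact mul_left_cancel₀ h1 (by rw [← map_mul, ← map_mul, hl])
    · exact mul_left_cancel₀ h2 (by rw [← map_mul, ← map_mul, hl])
  rw [charSum, charSum, Finset.sum_filter, Finset.sum_filter, ← hbij.sum_comp
    fun l => if whitemanChar n₁ n₂ l = whitemanChar n₁ n₂ k * ε then β ^ l.val else 0]
  refine Finset.sum_congr rfl fun l _ => ?_
  have hk0 : whitemanChar n₁ n₂ k ≠ 0 := by rcases hk with hk | hk <;> simp [hk]
  simp only [whitemanChar_mul, mul_right_inj' hk0, pow_val_pow_val hβ]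

theorem charSum_one_add_charSum_neg_one (h : n₁.Coprime n₂) {β : K}
    (hβ : IsPrimitiveRoot β (n₁ * n₂)) : charSum n₁ n₂ 1 β + charSum n₁ n₂ (-1) β = 1 := by
  have p1 := (Fact.out : n₁.Prime).one_lt
  have p2 := (Fact.out : n₂.Prime).one_lt
  have hn : 1 < n₁ * n₂ := by nlinarith
  have s0 : ∑ k : ZMod (n₁ * n₂), β ^ k.val = 0 := by
    have := sum_filter_dvd_val (n := n₁ * n₂) (m := 1) (one_mul _).symm fun i => β ^ i
    simp only [one_dvd, Finset.filter_true, one_mul] at this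
    rw [this, geom_sum_eq_zero hβ.pow_eq_one (hβ.ne_one hn)]
  have s1 : ∑ k : ZMod (n₁ * n₂) with n₁ ∣ k.val, β ^ k.val = 0 := by
    rw [sum_filter_dvd_val (q := n₂) rfl fun i => β ^ i]
    simp only [pow_mul]
    refine geom_sum_eq_zero (by rw [← pow_mul, hβ.pow_eq_one]) fun h => ?_
    have := Nat.le_of_dvd (by omega) (hβ.dvd_of_pow_eq_one _ h)
    nlinarith
  have s2 : ∑ k : ZMod (n₁ * n₂) with n₂ ∣ k.val, β ^ k.val = 0 := by
    rw [sum_filter_dvd_val (q := n₁) (mul_comm _ _) fun i => β ^ i]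
    simp only [pow_mul]
    refine geom_sum_eq_zero (by rw [← pow_mul, mul_comm, hβ.pow_eq_one]) fun h => ?_
    have := Nat.le_of_dvd (by omega) (hβ.dvd_of_pow_eq_one _ h)
    nlinarith
  have s3 : ∑ k : ZMod (n₁ * n₂), (if k = 0 then β ^ k.val else 0) = 1 := by simp
  rw [charSum, charSum, ← sub_eq_zero]
  -- Inclusion-exclusion: the units, the multiples of `n₁` and those of `n₂` cover everything, with
  -- only `0` counted twice. All complete sums vanish, so the unit sum equals the term at `0`.
  calc _ = (∑ k : ZMod (n₁ * n₂) with whitemanChar n₁ n₂ k = 1, β ^ k.val) +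
        (∑ k : ZMod (n₁ * n₂) with whitemanChar n₁ n₂ k = -1, β ^ k.val) +
        (∑ k : ZMod (n₁ * n₂) with n₁ ∣ k.val, β ^ k.val) +
        (∑ k : ZMod (n₁ * n₂) with n₂ ∣ k.val, β ^ k.val) -
        ∑ k : ZMod (n₁ * n₂), (if k = 0 then β ^ k.val else 0) := by
          rw [s1, s2, s3]; ring
    _ = ∑ k : ZMod (n₁ * n₂), β ^ k.val := by
      simp only [Finset.sum_filter, ← Finset.sum_add_distrib, ← Finset.sum_sub_distrib]
      refine Finset.sum_congr rfl fun k _ => ?_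
      simp only [← resFst_eq_zero_iff, ← resSnd_eq_zero_iff]
      by_cases h1 : resFst n₁ n₂ k = 0 <;> by_cases h2 : resSnd n₁ n₂ k = 0
      · have hk : k = 0 := eq_of_res_eq h (by rw [h1, map_zero]) (by rw [h2, map_zero])
        subst hk
        simp [whitemanChar]
      · have hk : k ≠ 0 := by rintro rfl; exact h2 (map_zero _)
        simp [(whitemanChar_eq_zero_iff k).2 (Or.inl h1), h1, h2, hk]
      · have hk : k ≠ 0 := by rintro rfl; exact h1 (map_zero _)
        simp [(whitemanChar_eq_zero_iff k).2 (Or.inr h2), h1, h2, hk]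
      · have hk : k ≠ 0 := by rintro rfl; exact h1 (map_zero _)
        rcases whitemanChar_eq_one_or_neg_one h1 h2 with hχ | hχ <;> simp [hχ, h1, h2, hk]
    _ = 0 := s0

theorem lamEval_of_isPrimitiveRoot (h : IsWhitemanSetting n₁ n₂ g u) {β : K}
    (hβ : IsPrimitiveRoot β (n₁ * n₂)) :
    lamEval n₁ n₂ g u β = charSum n₁ n₂ (-1) β - 1 := by
  have p1 := (Fact.out : n₁.Prime).one_lt
  have p2 := (Fact.out : n₂.Prime).one_lt
  rw [lamEval_eq h, geom_sum_eq_zero]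
  · ring
  · rw [← pow_mul, hβ.pow_eq_one]
  · intro h
    have := Nat.le_of_dvd (by omega) (hβ.dvd_of_pow_eq_one _ h)
    nlinarith

theorem pow_val_ne_one {n : ℕ} {β : K} (hβ : IsPrimitiveRoot β n) [NeZero n] {k : ZMod n}
    (hk : k ≠ 0) : β ^ k.val ≠ 1 := fun h => hk (pow_val_injective hβ (by simpa using h))

theorem lamEval_pow_val_of_eq_one (h : IsWhitemanSetting n₁ n₂ g u) {β : K}
    (hβ : IsPrimitiveRoot β (n₁ * n₂)) {k : ZMod (n₁ * n₂)} (hk : whitemanChar n₁ n₂ k = 1) :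
    lamEval n₁ n₂ g u (β ^ k.val) = lamEval n₁ n₂ g u β := by
  have hc : k.val.Coprime (n₁ * n₂) := coprime_val (Or.inl hk)
  rw [lamEval_of_isPrimitiveRoot h hβ, lamEval_of_isPrimitiveRoot h (hβ.pow_of_coprime _ hc),
    charSum_pow_val h hβ.pow_eq_one (Or.inl hk), hk, one_mul]

theorem aeval_seqPoly_wgcs [Algebra (ZMod 2) K] (γ : K) :
    aeval γ (seqPoly (n₁ * n₂) (wgcs n₁ n₂ g u)) = lamEval n₁ n₂ g u γ := by
  have := sum_univ_zmod_eq_sum_range (n := n₁ * n₂)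
    fun k => if k ∈ charSet n₁ n₂ g u then γ ^ k.val else 0
  rw [← Finset.sum_filter, Finset.filter_univ_mem] at this
  rw [lamEval, this, seqPoly, map_sum]
  refine Finset.sum_congr rfl fun i hi => ?_
  rw [wgcs, ZMod.val_cast_of_lt (Finset.mem_range.1 hi)]
  split_ifs <;> simp

variable [CharP K 2]

theorem lamEval_one (h : IsWhitemanSetting n₁ n₂ g u) : lamEval n₁ n₂ g u (1 : K) = 0 := by
  have o2 := (Fact.out : n₂.Prime).eq_two_or_odd'.resolve_left h.ne_two₂
  have hev : Even ((n₁ - 1) / 2 * (n₂ - 1)) := (Nat.Odd.sub_odd o2 odd_one).mul_left _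
  rw [lamEval_eq h, charSum]
  simp only [one_pow, Finset.sum_const, Finset.card_range, nsmul_eq_mul, mul_one]
  rw [card_filter_whitemanChar h.coprime h.ne_two₁ (Or.inr rfl), CharTwo.natCast_eq_ite,
    CharTwo.natCast_eq_ite, if_neg (Nat.not_even_iff_odd.2 o2), if_pos hev]
  ring

theorem lamEval_pow_val_eq_zero_iff_fst (h : IsWhitemanSetting n₁ n₂ g u) {β : K}
    (hβ : IsPrimitiveRoot β (n₁ * n₂)) {k : ZMod (n₁ * n₂)} (hk : k ≠ 0)
    (hk₁ : resFst n₁ n₂ k = 0) :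
    lamEval n₁ n₂ g u (β ^ k.val) = 0 ↔ n₁ % 4 = 3 := by
  have o1 := (Fact.out : n₁.Prime).eq_two_or_odd'.resolve_left h.ne_two₁
  have hγ1 : β ^ k.val ≠ 1 := pow_val_ne_one hβ hk
  have hγ : (β ^ k.val) ^ n₂ = 1 := by
    obtain ⟨j, hj⟩ := (resFst_eq_zero_iff k).1 hk₁
    rw [hj, ← pow_mul, mul_right_comm, pow_mul, hβ.pow_eq_one, one_pow]
  -- Coprimality of the exponents `n₁` and `n₂` would force the root to be `1`. Hence the geometric
  -- sum from `P` vanishes and, in characteristic 2, the value is `1 + (n₁ - 1) / 2`.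
  have hγ2 : (β ^ k.val) ^ n₁ ≠ 1 := fun h' => hγ1 (by
    have := pow_gcd_eq_one.2 ⟨h', hγ⟩
    rwa [h.coprime, pow_one] at this)
  rw [lamEval_eq h, charSum_eq_of_pow_snd h (Or.inr rfl) hγ hγ1, geom_sum_eq_zero _ hγ2,
    CharTwo.natCast_eq_ite]
  · obtain ⟨m, rfl⟩ := o1
    rw [show (2 * m + 1 - 1) / 2 = m by omega]
    split_ifs with he
    · obtain ⟨m, rfl⟩ := he
      simp
      omega
    · obtain ⟨m, rfl⟩ := Nat.not_even_iff_odd.1 he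
      simp [CharTwo.add_self_eq_zero]
      omega
  · rw [pow_right_comm, hγ, one_pow]

/-- Here every term from `P` is `1`, so `P` contributes `n₂ - 1`, which is even. What remains is the
parity of `(n₂ - 1) / 2`. -/
theorem lamEval_pow_val_eq_zero_iff_snd (h : IsWhitemanSetting n₁ n₂ g u) {β : K}
    (hβ : IsPrimitiveRoot β (n₁ * n₂)) {k : ZMod (n₁ * n₂)} (hk : k ≠ 0)
    (hk₂ : resSnd n₁ n₂ k = 0) :
    lamEval n₁ n₂ g u (β ^ k.val) = 0 ↔ n₂ % 4 = 1 := by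
  have o2 := (Fact.out : n₂.Prime).eq_two_or_odd'.resolve_left h.ne_two₂
  have hγ1 : β ^ k.val ≠ 1 := pow_val_ne_one hβ hk
  have hγ : (β ^ k.val) ^ n₁ = 1 := by
    obtain ⟨j, hj⟩ := (resSnd_eq_zero_iff k).1 hk₂
    rw [hj, ← pow_mul, mul_right_comm, mul_comm n₂, pow_mul, hβ.pow_eq_one, one_pow]
  rw [lamEval_eq h, charSum_eq_of_pow_fst h (Or.inr rfl) hγ hγ1, hγ]
  simp only [one_pow, Finset.sum_const, Finset.card_range, nsmul_eq_mul, mul_one]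
  rw [CharTwo.natCast_eq_ite n₂, if_neg (Nat.not_even_iff_odd.2 o2), CharTwo.natCast_eq_ite]
  obtain ⟨m, rfl⟩ := o2
  rw [show (2 * m + 1 - 1) / 2 = m by omega]
  split_ifs with he
  · obtain ⟨m, rfl⟩ := he
    simp
    omega
  · obtain ⟨m, rfl⟩ := Nat.not_even_iff_odd.1 he
    simp
    omega

/-- Such a `k` swaps the two character sums, and they add up to `1`. -/
theorem lamEval_pow_val_of_eq_neg_one (h : IsWhitemanSetting n₁ n₂ g u) {β : K}
    (hβ : IsPrimitiveRoot β (n₁ * n₂)) {k : ZMod (n₁ * n₂)} (hk : whitemanChar n₁ n₂ k = -1) :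
    lamEval n₁ n₂ g u (β ^ k.val) = lamEval n₁ n₂ g u β + 1 := by
  have hc : k.val.Coprime (n₁ * n₂) := coprime_val (Or.inr hk)
  have h1 := charSum_one_add_charSum_neg_one h.coprime hβ
  have h2 : (2 : K) = 0 := CharTwo.two_eq_zero
  rw [lamEval_of_isPrimitiveRoot h hβ, lamEval_of_isPrimitiveRoot h (hβ.pow_of_coprime _ hc),
    charSum_pow_val h hβ.pow_eq_one (Or.inr hk), hk]
  norm_num
  linear_combination h1 - charSum n₁ n₂ (-1) β * h2

end Values

/-! ### Zeros of `Λ` at non-units and at units. -/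

section ZeroSet

variable {n₁ n₂ : ℕ} [Fact n₁.Prime] [Fact n₂.Prime] {g u : ℤ}
variable {K : Type*} [Field K]

open scoped Classical in
/-- The product of `x - β ^ k` over the zeros `β ^ k` of `Λ` with `k` not invertible. -/
def nonunitFactor (n₁ n₂ : ℕ) [Fact n₁.Prime] [Fact n₂.Prime] (g u : ℤ) (β : K) : K[X] :=
  ∏ k : ZMod (n₁ * n₂) with whitemanChar n₁ n₂ k = 0 ∧ lamEval n₁ n₂ g u (β ^ k.val) = 0,
    (X - C (β ^ k.val))

open scoped Classical in
/-- The product of `x - β ^ k` over the zeros `β ^ k` of `Λ` with `k` invertible. -/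
def unitFactor (n₁ n₂ : ℕ) [Fact n₁.Prime] [Fact n₂.Prime] (g u : ℤ) (β : K) : K[X] :=
  ∏ k : ZMod (n₁ * n₂) with whitemanChar n₁ n₂ k ≠ 0 ∧ lamEval n₁ n₂ g u (β ^ k.val) = 0,
    (X - C (β ^ k.val))

theorem map_gLam_mul [Algebra (ZMod 2) K] {β : K} (hβ : IsPrimitiveRoot β (n₁ * n₂)) :
    (gLam n₁ n₂ g u).map (algebraMap (ZMod 2) K) *
      (nonunitFactor n₁ n₂ g u β * unitFactor n₁ n₂ g u β) = X ^ (n₁ * n₂) - 1 := by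
  classical
  rw [← map_seqGenerator_mul_prod hβ (wgcs n₁ n₂ g u)
    (Z := Finset.univ.filter fun k => lamEval n₁ n₂ g u (β ^ k.val) = 0)
    fun k => by rw [aeval_seqPoly_wgcs, Finset.mem_filter, and_iff_right (Finset.mem_univ k)],
    ← Finset.prod_filter_mul_prod_filter_not _ fun k => whitemanChar n₁ n₂ k = 0,
    Finset.filter_filter, Finset.filter_filter, gLam, nonunitFactor, unitFactor]
  simp only [and_comm, ne_eq]

variable [CharP K 2]

theorem whitemanChar_eq_zero_and_lamEval_iff (h : IsWhitemanSetting n₁ n₂ g u) {β : K}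
    (hβ : IsPrimitiveRoot β (n₁ * n₂)) (k : ZMod (n₁ * n₂)) :
    (whitemanChar n₁ n₂ k = 0 ∧ lamEval n₁ n₂ g u (β ^ k.val) = 0) ↔
      k = 0 ∨ (n₁ ∣ k.val ∧ n₁ % 4 = 3) ∨ (n₂ ∣ k.val ∧ n₂ % 4 = 1) := by
  by_cases hk : k = 0
  · subst hk
    simp [lamEval_one h, whitemanChar]
  rw [whitemanChar_eq_zero_iff, ← resFst_eq_zero_iff, ← resSnd_eq_zero_iff]
  have hne : ¬ (resFst n₁ n₂ k = 0 ∧ resSnd n₁ n₂ k = 0) := fun h' =>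
    hk (eq_of_res_eq h.coprime (by rw [h'.1, map_zero]) (by rw [h'.2, map_zero]))
  by_cases h1 : resFst n₁ n₂ k = 0
  · have h2 : resSnd n₁ n₂ k ≠ 0 := fun h2 => hne ⟨h1, h2⟩
    simp [h1, h2, hk, lamEval_pow_val_eq_zero_iff_fst h hβ hk h1]
  · by_cases h2 : resSnd n₁ n₂ k = 0
    · simp [h1, h2, hk, lamEval_pow_val_eq_zero_iff_snd h hβ hk h2]
    · simp [h1, h2, hk]

theorem nonunitFactor_eq_of_one_three (h : IsWhitemanSetting n₁ n₂ g u) {β : K}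
    (hβ : IsPrimitiveRoot β (n₁ * n₂)) (h1 : n₁ % 4 = 1) (h2 : n₂ % 4 = 3) :
    nonunitFactor n₁ n₂ g u β = X - 1 := by
  have : (Finset.univ.filter fun k : ZMod (n₁ * n₂) => k = 0) = {0} := by ext; simp
  simp [nonunitFactor, whitemanChar_eq_zero_and_lamEval_iff h hβ, h1, h2, this]

theorem nonunitFactor_eq_of_three_three (h : IsWhitemanSetting n₁ n₂ g u) {β : K}
    (hβ : IsPrimitiveRoot β (n₁ * n₂)) (h1 : n₁ % 4 = 3) (h2 : n₂ % 4 = 3) :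
    nonunitFactor n₁ n₂ g u β = X ^ n₂ - 1 := by
  classical
  rw [← prod_filter_dvd_val (m := n₁) (q := n₂) rfl hβ, nonunitFactor]
  refine Finset.prod_congr (Finset.filter_congr fun k _ => ?_) fun _ _ => rfl
  rw [whitemanChar_eq_zero_and_lamEval_iff h hβ]
  by_cases hk : k = 0 <;> simp [hk, h1, h2]

theorem nonunitFactor_mul_eq_of_three_one (h : IsWhitemanSetting n₁ n₂ g u) {β : K}
    (hβ : IsPrimitiveRoot β (n₁ * n₂)) (h1 : n₁ % 4 = 3) (h2 : n₂ % 4 = 1) :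
    nonunitFactor n₁ n₂ g u β * (X - 1) = (X ^ n₁ - 1) * (X ^ n₂ - 1) := by
  classical
  -- The zeros form the union of the two sets of multiples; they meet only in `0`, whose factor is
  -- `X - 1`.
  rw [mul_comm (X ^ n₁ - 1), ← prod_filter_dvd_val (m := n₁) (q := n₂) rfl hβ,
    ← prod_filter_dvd_val (m := n₂) (q := n₁) (mul_comm _ _) hβ, ← Finset.prod_union_inter,
    nonunitFactor]
  congr 1
  · refine Finset.prod_congr ?_ fun _ _ => rfl
    ext k
    rw [Finset.mem_filter, whitemanChar_eq_zero_and_lamEval_iff h hβ]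
    by_cases hk : k = 0 <;> simp [hk, h1, h2]
  · have : ((Finset.univ.filter fun k : ZMod (n₁ * n₂) => n₁ ∣ k.val) ∩
        Finset.univ.filter fun k => n₂ ∣ k.val) = {0} := by
      ext k
      simp only [Finset.mem_inter, Finset.mem_filter, Finset.mem_univ, true_and,
        Finset.mem_singleton, ← resFst_eq_zero_iff, ← resSnd_eq_zero_iff]
      constructor
      · exact fun h' => eq_of_res_eq h.coprime (by rw [h'.1, map_zero]) (by rw [h'.2, map_zero])
      · rintro rfl
        simp
    rw [this]
    simp

/-- Frobenius: squaring `Λ(β)` moves the argument to `β^2`, so the witness is `2`, whose character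
is given by the second supplementary law. -/
theorem lamEval_pow_two (h : IsWhitemanSetting n₁ n₂ g u) (β : K) :
    ∃ k : ZMod (n₁ * n₂), whitemanChar n₁ n₂ k = ZMod.χ₈ n₁ * ZMod.χ₈ n₂ ∧
      lamEval n₁ n₂ g u β ^ 2 = lamEval n₁ n₂ g u (β ^ k.val) := by
  refine ⟨2, whitemanChar_two h.ne_two₁ h.ne_two₂, ?_⟩
  have p1 := (Fact.out : n₁.Prime).two_le
  have p2 := (Fact.out : n₂.Prime).two_le
  have hv : (2 : ZMod (n₁ * n₂)).val = 2 :=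
    ZMod.val_cast_of_lt (n := n₁ * n₂) (a := 2) (by nlinarith)
  rw [lamEval_sq, hv]

theorem unitFactor_eq_one (h : IsWhitemanSetting n₁ n₂ g u) {β : K}
    (hβ : IsPrimitiveRoot β (n₁ * n₂)) (h2 : ZMod.χ₈ n₁ * ZMod.χ₈ n₂ = -1) :
    unitFactor n₁ n₂ g u β = 1 := by
  classical
  obtain ⟨l, hl, hsq⟩ := lamEval_pow_two h β
  -- Now `Λ(β)^2 = Λ(β) + 1`, which excludes the values `0` and `1`; a zero at a unit would force
  -- one of them.
  rw [lamEval_pow_val_of_eq_neg_one h hβ (hl.trans h2)] at hsq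
  rw [unitFactor, Finset.filter_false_of_mem, Finset.prod_empty]
  rintro k - ⟨hk, h0⟩
  rw [Ne, whitemanChar_eq_zero_iff, not_or] at hk
  rcases whitemanChar_eq_one_or_neg_one hk.1 hk.2 with hk | hk
  · rw [lamEval_pow_val_of_eq_one h hβ hk] at h0
    simp [h0] at hsq
  · rw [lamEval_pow_val_of_eq_neg_one h hβ hk] at h0
    rw [h0, sq_eq_zero_iff] at hsq
    simp [hsq] at h0

theorem unitFactor_eq (h : IsWhitemanSetting n₁ n₂ g u) {β : K}
    (hβ : IsPrimitiveRoot β (n₁ * n₂)) (h2 : ZMod.χ₈ n₁ * ZMod.χ₈ n₂ = 1) :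
    (lamEval n₁ n₂ g u β = 0 ∧ unitFactor n₁ n₂ g u β = d₀ n₁ n₂ g u β) ∨
      (lamEval n₁ n₂ g u β = 1 ∧ unitFactor n₁ n₂ g u β = d₁ n₁ n₂ g u β) := by
  classical
  obtain ⟨l, hl, hsq⟩ := lamEval_pow_two h β
  rw [lamEval_pow_val_of_eq_one h hβ (hl.trans h2)] at hsq
  have h01 : lamEval n₁ n₂ g u β = 0 ∨ lamEval n₁ n₂ g u β = 1 := by
    rw [or_iff_not_imp_left]
    exact fun h0 => mul_left_cancel₀ h0 (by rw [← sq, hsq, mul_one])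
  have hone : (1 : K) + 1 = 0 := CharTwo.add_self_eq_zero 1
  refine h01.imp (fun h0 => ⟨h0, ?_⟩) fun h0 => ⟨h0, ?_⟩
  · rw [unitFactor, d₀, h.evenClasses_eq]
    refine Finset.prod_congr (Finset.filter_congr fun k _ => ?_) fun _ _ => rfl
    by_cases hk : whitemanChar n₁ n₂ k = 0
    · simp [hk]
    · rw [whitemanChar_eq_zero_iff, not_or] at hk
      rcases whitemanChar_eq_one_or_neg_one hk.1 hk.2 with hk | hk
      · simp [hk, lamEval_pow_val_of_eq_one h hβ hk, h0]
      · simp [hk, lamEval_pow_val_of_eq_neg_one h hβ hk, h0]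
  · rw [unitFactor, d₁, h.oddClasses_eq]
    refine Finset.prod_congr (Finset.filter_congr fun k _ => ?_) fun _ _ => rfl
    by_cases hk : whitemanChar n₁ n₂ k = 0
    · simp [hk]
    · rw [whitemanChar_eq_zero_iff, not_or] at hk
      rcases whitemanChar_eq_one_or_neg_one hk.1 hk.2 with hk | hk
      · simp [hk, lamEval_pow_val_of_eq_one h hβ hk, h0]
      · simp [hk, lamEval_pow_val_of_eq_neg_one h hβ hk, h0, hone]

/-- `D₀` and `D₁` have equal size, so the degree does not depend on which alternative holds for `β`.
-/
theorem natDegree_unitFactor (h : IsWhitemanSetting n₁ n₂ g u) {β : K}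
    (hβ : IsPrimitiveRoot β (n₁ * n₂)) (h2 : ZMod.χ₈ n₁ * ZMod.χ₈ n₂ = 1) :
    (unitFactor n₁ n₂ g u β).natDegree = (n₁ - 1) / 2 * (n₂ - 1) := by
  rcases unitFactor_eq h hβ h2 with ⟨-, he⟩ | ⟨-, he⟩
  · rw [he, d₀, natDegree_prod_X_sub_C', h.evenClasses_eq,
      card_filter_whitemanChar h.coprime h.ne_two₁ (Or.inl rfl)]
  · rw [he, d₁, natDegree_prod_X_sub_C', h.oddClasses_eq,
      card_filter_whitemanChar h.coprime h.ne_two₁ (Or.inr rfl)]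

end ZeroSet

/-! ### From the factorization to linear span, dimension and the values of `χ₈`. -/

section Conclusions

variable {n₁ n₂ : ℕ} [Fact n₁.Prime] [Fact n₂.Prime] {g u : ℤ}

theorem isGeneratorPolynomial_gLam :
    IsGeneratorPolynomial (codeLam n₁ n₂ g u) (gLam n₁ n₂ g u) :=
  isGeneratorPolynomial_seqGenerator (NeZero.pos _) _

theorem hasLinearSpan_wgcs {k : ℕ} (hk : (gLam n₁ n₂ g u).natDegree + k = n₁ * n₂) :
    HasLinearSpan (wgcs n₁ n₂ g u) (n₁ * n₂ - k) := by
  have := hasLinearSpan_natDegree_seqGenerator (NeZero.pos (n₁ * n₂)) (s := wgcs n₁ n₂ g u)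
    fun i => by simp only [wgcs, Nat.cast_add, ZMod.natCast_self, add_zero]
  rwa [← hk, Nat.add_sub_cancel]

theorem exists_hasParameters_codeLam {k : ℕ} (hk : (gLam n₁ n₂ g u).natDegree + k = n₁ * n₂)
    (hk0 : 0 < k) : ∃ d, HasParameters (codeLam n₁ n₂ g u) k d := by
  refine exists_hasParameters_of_finrank_eq ?_ hk0
  have := finrank_cyclicCode (NeZero.pos (n₁ * n₂))
    (seqGenerator_dvd (NeZero.pos (n₁ * n₂)) (wgcs n₁ n₂ g u))
  refine this.trans ?_
  change n₁ * n₂ - (gLam n₁ n₂ g u).natDegree = k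
  omega

theorem hasParameters_of_mul_X_pow_sub_one {n m q : ℕ} (hn : n = m * q) (hn0 : 0 < n)
    {p : (ZMod 2)[X]} (hp : p * (X ^ m - 1) = X ^ n - 1) :
    HasParameters (cyclicCode n p) m q := by
  subst hn
  exact hasParameters_cyclicCode_of_mul_eq (Nat.pos_of_mul_pos_right hn0)
    (Nat.pos_of_mul_pos_left hn0) hp

theorem natDegree_add_of_mul_eq {n : ℕ} {p q : (ZMod 2)[X]} (hn : 0 < n)
    (h : p * q = X ^ n - 1) : p.natDegree + q.natDegree = n := by
  have hne : p * q ≠ 0 := h ▸ X_pow_sub_one_ne_zero' hn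
  rw [← natDegree_mul (left_ne_zero_of_mul hne) (right_ne_zero_of_mul hne), h,
    natDegree_X_pow_sub_one']

/-- The degree of `g_λ` read off from its factorization over an algebraic closure. -/
theorem natDegree_gLam_add {K : Type*} [Field K] [Algebra (ZMod 2) K] {β : K}
    (hβ : IsPrimitiveRoot β (n₁ * n₂)) :
    (gLam n₁ n₂ g u).natDegree + ((nonunitFactor n₁ n₂ g u β).natDegree +
      (unitFactor n₁ n₂ g u β).natDegree) = n₁ * n₂ := by
  have h := map_gLam_mul (g := g) (u := u) hβ
  have hne := h ▸ X_pow_sub_one_ne_zero' (F := K) (NeZero.pos (n₁ * n₂))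
  have hne' := right_ne_zero_of_mul hne
  rw [← natDegree_map (algebraMap (ZMod 2) K),
    ← natDegree_mul (left_ne_zero_of_mul hne') (right_ne_zero_of_mul hne'),
    ← natDegree_mul (left_ne_zero_of_mul hne) hne', h, natDegree_X_pow_sub_one']

theorem natDegree_nonunitFactor_of_three_one {K : Type*} [Field K] [CharP K 2]
    (h : IsWhitemanSetting n₁ n₂ g u) {β : K} (hβ : IsPrimitiveRoot β (n₁ * n₂))
    (h1 : n₁ % 4 = 3) (h2 : n₂ % 4 = 1) :
    (nonunitFactor n₁ n₂ g u β).natDegree + 1 = n₁ + n₂ := by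
  have p1 := (Fact.out : n₁.Prime).pos
  have p2 := (Fact.out : n₂.Prime).pos
  have he := nonunitFactor_mul_eq_of_three_one h hβ h1 h2
  have hne := mul_ne_zero (X_pow_sub_one_ne_zero' (F := K) p1) (X_pow_sub_one_ne_zero' (F := K) p2)
  have hd := congrArg natDegree he
  rw [natDegree_mul (X_pow_sub_one_ne_zero' p1) (X_pow_sub_one_ne_zero' p2),
    natDegree_mul (left_ne_zero_of_mul (he ▸ hne)) (right_ne_zero_of_mul (he ▸ hne)),
    natDegree_X_pow_sub_one', natDegree_X_pow_sub_one'] at hd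
  rw [← hd, ← pow_one (X : K[X]), natDegree_X_pow_sub_one']

theorem χ₈_natCast_eq_of_odd {a : ℕ} (ha : a % 2 = 1) :
    ZMod.χ₈ (a : ZMod 8) = if a % 8 = 1 ∨ a % 8 = 7 then 1 else -1 := by
  rw [ZMod.χ₈_nat_eq_if_mod_eight, if_neg (by omega : ¬ a % 2 = 0)]

theorem χ₈_mul_χ₈_eq_one {a b : ℕ} (ha : a % 2 = 1) (hb : b % 2 = 1)
    (h : (a % 8 = 1 ∨ a % 8 = 7) ↔ (b % 8 = 1 ∨ b % 8 = 7)) :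
    ZMod.χ₈ (a : ZMod 8) * ZMod.χ₈ (b : ZMod 8) = 1 := by
  rw [χ₈_natCast_eq_of_odd ha, χ₈_natCast_eq_of_odd hb]
  simp only [h]
  split_ifs <;> norm_num

theorem χ₈_mul_χ₈_eq_neg_one {a b : ℕ} (ha : a % 2 = 1) (hb : b % 2 = 1)
    (h : (a % 8 = 1 ∨ a % 8 = 7) ↔ ¬(b % 8 = 1 ∨ b % 8 = 7)) :
    ZMod.χ₈ (a : ZMod 8) * ZMod.χ₈ (b : ZMod 8) = -1 := by
  rw [χ₈_natCast_eq_of_odd ha, χ₈_natCast_eq_of_odd hb]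
  simp only [h]
  split_ifs <;> norm_num

end Conclusions

end CyclicCodes

end

/-! ### The six congruence cases. -/

open CyclicCodes in
theorem mainTheorem4 (n₁ n₂ : ℕ) (hn₁ : n₁.Prime) (hn₂ : n₂.Prime)
    (hodd₁ : Odd n₁) (hodd₂ : Odd n₂) (hne : n₁ ≠ n₂)
    (hd : whitemanOrder n₁ n₂ = 6) (g u : ℤ)
    (hg₁ : IsPrimitiveRootMod g n₁) (hg₂ : IsPrimitiveRootMod g n₂)
    (hu₁ : u ≡ g [ZMOD n₁]) (hu₂ : u ≡ 1 [ZMOD n₂]) :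
    (((n₁ ≡ 13 [MOD 24] ∧ n₂ ≡ 7 [MOD 24]) ∨ (n₁ ≡ 1 [MOD 24] ∧ n₂ ≡ 19 [MOD 24])) →
      gLam n₁ n₂ g u * (X - 1) = X ^ (n₁ * n₂) - 1 ∧
      HasLinearSpan (wgcs n₁ n₂ g u) (n₁ * n₂ - 1) ∧
      HasParameters (codeLam n₁ n₂ g u) 1 (n₁ * n₂) ∧
      IsGeneratorPolynomial (codeLam n₁ n₂ g u) (gLam n₁ n₂ g u)) ∧
    (((n₁ ≡ 7 [MOD 24] ∧ n₂ ≡ 19 [MOD 24]) ∨ (n₁ ≡ 19 [MOD 24] ∧ n₂ ≡ 7 [MOD 24])) →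
      gLam n₁ n₂ g u * (X ^ n₂ - 1) = X ^ (n₁ * n₂) - 1 ∧
      HasLinearSpan (wgcs n₁ n₂ g u) (n₁ * n₂ - n₂) ∧
      HasParameters (codeLam n₁ n₂ g u) n₂ n₁ ∧
      IsGeneratorPolynomial (codeLam n₁ n₂ g u) (gLam n₁ n₂ g u)) ∧
    (((n₁ ≡ 7 [MOD 24] ∧ n₂ ≡ 13 [MOD 24]) ∨ (n₁ ≡ 19 [MOD 24] ∧ n₂ ≡ 1 [MOD 24])) →
      gLam n₁ n₂ g u * ((X ^ n₁ - 1) * (X ^ n₂ - 1)) = (X ^ (n₁ * n₂) - 1) * (X - 1) ∧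
      HasLinearSpan (wgcs n₁ n₂ g u) (n₁ * n₂ - (n₁ + n₂ - 1)) ∧
      (∃ d, HasParameters (codeLam n₁ n₂ g u) (n₁ + n₂ - 1) d) ∧
      IsGeneratorPolynomial (codeLam n₁ n₂ g u) (gLam n₁ n₂ g u)) ∧
    (((n₁ ≡ 1 [MOD 24] ∧ n₂ ≡ 7 [MOD 24]) ∨ (n₁ ≡ 13 [MOD 24] ∧ n₂ ≡ 19 [MOD 24])) →
      (∀ (K : Type v) [Field K] [Algebra (ZMod 2) K] (β : K), IsPrimitiveRoot β (n₁ * n₂) →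
        (lamEval n₁ n₂ g u β = 0 ∧
          (gLam n₁ n₂ g u).map (algebraMap (ZMod 2) K) * ((X - 1) * d₀ n₁ n₂ g u β) =
            X ^ (n₁ * n₂) - 1) ∨
        (lamEval n₁ n₂ g u β = 1 ∧
          (gLam n₁ n₂ g u).map (algebraMap (ZMod 2) K) * ((X - 1) * d₁ n₁ n₂ g u β) =
            X ^ (n₁ * n₂) - 1)) ∧
      HasLinearSpan (wgcs n₁ n₂ g u) (n₁ * n₂ - ((n₁ - 1) * (n₂ - 1) + 2) / 2) ∧
      (∃ d, HasParameters (codeLam n₁ n₂ g u) (((n₁ - 1) * (n₂ - 1) + 2) / 2) d) ∧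
      IsGeneratorPolynomial (codeLam n₁ n₂ g u) (gLam n₁ n₂ g u)) ∧
    (((n₁ ≡ 7 [MOD 24] ∧ n₂ ≡ 7 [MOD 24]) ∨ (n₁ ≡ 19 [MOD 24] ∧ n₂ ≡ 19 [MOD 24])) →
      (∀ (K : Type v) [Field K] [Algebra (ZMod 2) K] (β : K), IsPrimitiveRoot β (n₁ * n₂) →
        (lamEval n₁ n₂ g u β = 0 ∧
          (gLam n₁ n₂ g u).map (algebraMap (ZMod 2) K) * ((X ^ n₂ - 1) * d₀ n₁ n₂ g u β) =
            X ^ (n₁ * n₂) - 1) ∨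
        (lamEval n₁ n₂ g u β = 1 ∧
          (gLam n₁ n₂ g u).map (algebraMap (ZMod 2) K) * ((X ^ n₂ - 1) * d₁ n₁ n₂ g u β) =
            X ^ (n₁ * n₂) - 1)) ∧
      HasLinearSpan (wgcs n₁ n₂ g u) (n₁ * n₂ - ((n₁ + 1) * (n₂ - 1) + 2) / 2) ∧
      (∃ d, HasParameters (codeLam n₁ n₂ g u) (((n₁ + 1) * (n₂ - 1) + 2) / 2) d) ∧
      IsGeneratorPolynomial (codeLam n₁ n₂ g u) (gLam n₁ n₂ g u)) ∧
    (((n₁ ≡ 7 [MOD 24] ∧ n₂ ≡ 1 [MOD 24]) ∨ (n₁ ≡ 19 [MOD 24] ∧ n₂ ≡ 13 [MOD 24])) →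
      (∀ (K : Type v) [Field K] [Algebra (ZMod 2) K] (β : K), IsPrimitiveRoot β (n₁ * n₂) →
        (lamEval n₁ n₂ g u β = 0 ∧
          (gLam n₁ n₂ g u).map (algebraMap (ZMod 2) K) *
            ((X ^ n₁ - 1) * (X ^ n₂ - 1) * d₀ n₁ n₂ g u β) =
            (X ^ (n₁ * n₂) - 1) * (X - 1)) ∨
        (lamEval n₁ n₂ g u β = 1 ∧
          (gLam n₁ n₂ g u).map (algebraMap (ZMod 2) K) *
            ((X ^ n₁ - 1) * (X ^ n₂ - 1) * d₁ n₁ n₂ g u β) =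
            (X ^ (n₁ * n₂) - 1) * (X - 1))) ∧
      HasLinearSpan (wgcs n₁ n₂ g u) (n₁ * n₂ - ((n₁ + 1) * (n₂ + 1) - 2) / 2) ∧
      (∃ d, HasParameters (codeLam n₁ n₂ g u) (((n₁ + 1) * (n₂ + 1) - 2) / 2) d) ∧
      IsGeneratorPolynomial (codeLam n₁ n₂ g u) (gLam n₁ n₂ g u)) := by
  have : Fact n₁.Prime := ⟨hn₁⟩
  have : Fact n₂.Prime := ⟨hn₂⟩
  have p1 := hn₁.two_le
  have p2 := hn₂.two_le
  have hn : 0 < n₁ * n₂ := NeZero.pos _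
  have hS : IsWhitemanSetting n₁ n₂ g u :=
    ⟨fun h => absurd (h ▸ hodd₁) (by decide), fun h => absurd (h ▸ hodd₂) (by decide),
      (Nat.coprime_primes hn₁ hn₂).2 hne, hd, hg₁, hg₂, hu₁, hu₂⟩
  -- As `n₁ * n₂` is odd it is invertible in characteristic 2, so a primitive root of that order
  -- exists in the algebraic closure. That root serves to compute degrees and, by injectivity of
  -- coefficient extension, identities over `GF(2)`.
  have : NeZero ((n₁ * n₂ : ℕ) : AlgebraicClosure (ZMod 2)) := ⟨by
    have : CharP (AlgebraicClosure (ZMod 2)) 2 := inferInstance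
    rw [CharTwo.natCast_eq_ite, if_neg (Nat.not_even_iff_odd.2 (hodd₁.mul hodd₂))]
    exact one_ne_zero⟩
  obtain ⟨β, hβ⟩ :=
    HasEnoughRootsOfUnity.exists_primitiveRoot (AlgebraicClosure (ZMod 2)) (n₁ * n₂)
  have hmap := map_gLam_mul (g := g) (u := u) hβ
  have hdeg := natDegree_gLam_add (g := g) (u := u) hβ
  have hinj := map_injective (algebraMap (ZMod 2) (AlgebraicClosure (ZMod 2)))
    (algebraMap (ZMod 2) (AlgebraicClosure (ZMod 2))).injective
  have hchar (K : Type v) [Field K] [Algebra (ZMod 2) K] : CharP K 2 :=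
    charP_of_injective_algebraMap (algebraMap (ZMod 2) K).injective 2
  obtain ⟨a, ha⟩ := hodd₁
  obtain ⟨b, hb⟩ := hodd₂
  have ha1 : (n₁ - 1) / 2 = a := by omega
  have hb1 : n₂ - 1 = 2 * b := by omega
  -- Only residues modulo 8 matter below: those modulo 4 select the non-unit factor, and the `χ₈`
  -- product selects the unit factor.
  refine ⟨fun h => ?_, fun h => ?_, fun h => ?_, fun h => ?_, fun h => ?_, fun h => ?_⟩ <;>
    simp only [Nat.ModEq] at h
  · have h1 : n₁ % 4 = 1 := by omega
    have h2 : n₂ % 4 = 3 := by omega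
    have hχ := χ₈_mul_χ₈_eq_neg_one (a := n₁) (b := n₂) (by omega) (by omega) (by omega)
    have hG : gLam n₁ n₂ g u * (X - 1) = X ^ (n₁ * n₂) - 1 := by
      apply hinj
      rw [nonunitFactor_eq_of_one_three hS hβ h1 h2, unitFactor_eq_one hS hβ hχ, mul_one] at hmap
      simpa using hmap
    -- Block length `1`: the code is the repetition code.
    have hG' : gLam n₁ n₂ g u * (X ^ 1 - 1) = X ^ (n₁ * n₂) - 1 := by rwa [pow_one]
    have hk := natDegree_add_of_mul_eq hn hG'
    rw [natDegree_X_pow_sub_one'] at hk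
    exact ⟨hG, hasLinearSpan_wgcs hk,
      hasParameters_of_mul_X_pow_sub_one (one_mul _).symm hn hG', isGeneratorPolynomial_gLam⟩
  · have h1 : n₁ % 4 = 3 := by omega
    have h2 : n₂ % 4 = 3 := by omega
    have hχ := χ₈_mul_χ₈_eq_neg_one (a := n₁) (b := n₂) (by omega) (by omega) (by omega)
    have hG : gLam n₁ n₂ g u * (X ^ n₂ - 1) = X ^ (n₁ * n₂) - 1 := by
      apply hinj
      rw [nonunitFactor_eq_of_three_three hS hβ h1 h2, unitFactor_eq_one hS hβ hχ, mul_one] at hmap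
      simpa using hmap
    have hk := natDegree_add_of_mul_eq hn hG
    rw [natDegree_X_pow_sub_one'] at hk
    exact ⟨hG, hasLinearSpan_wgcs hk,
      hasParameters_of_mul_X_pow_sub_one (mul_comm _ _) hn hG, isGeneratorPolynomial_gLam⟩
  · have h1 : n₁ % 4 = 3 := by omega
    have h2 : n₂ % 4 = 1 := by omega
    have hχ := χ₈_mul_χ₈_eq_neg_one (a := n₁) (b := n₂) (by omega) (by omega) (by omega)
    have hN := natDegree_nonunitFactor_of_three_one hS hβ h1 h2
    rw [unitFactor_eq_one hS hβ hχ, natDegree_one] at hdeg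
    have hk : (gLam n₁ n₂ g u).natDegree + (n₁ + n₂ - 1) = n₁ * n₂ := by omega
    refine ⟨?_, hasLinearSpan_wgcs hk, exists_hasParameters_codeLam hk (by omega),
      isGeneratorPolynomial_gLam⟩
    apply hinj
    rw [unitFactor_eq_one hS hβ hχ, mul_one] at hmap
    have he := nonunitFactor_mul_eq_of_three_one hS hβ h1 h2
    simp only [Polynomial.map_mul, Polynomial.map_sub, Polynomial.map_pow, map_X,
      Polynomial.map_one]
    rw [← he, ← hmap, mul_assoc]
  · have h1 : n₁ % 4 = 1 := by omega
    have h2 : n₂ % 4 = 3 := by omega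
    have hχ := χ₈_mul_χ₈_eq_one (a := n₁) (b := n₂) (by omega) (by omega) (by omega)
    rw [natDegree_unitFactor hS hβ hχ, nonunitFactor_eq_of_one_three hS hβ h1 h2,
      ← pow_one (X : (AlgebraicClosure (ZMod 2))[X]), natDegree_X_pow_sub_one'] at hdeg
    have hk : (gLam n₁ n₂ g u).natDegree + ((n₁ - 1) * (n₂ - 1) + 2) / 2 = n₁ * n₂ := by
      rw [← hdeg, ha1, hb1, ha, show (2 * a + 1 - 1) * (2 * b) + 2 = 2 * (1 + a * (2 * b)) by
        rw [Nat.add_sub_cancel]; ring, Nat.mul_div_cancel_left _ two_pos]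
    -- The degree of `g_λ` is already fixed by the root in the algebraic closure; the factorization
    -- is proved afresh for an arbitrary `K` and `β`.
    refine ⟨fun K _ _ β hβ => ?_, hasLinearSpan_wgcs hk,
      exists_hasParameters_codeLam hk (by omega), isGeneratorPolynomial_gLam⟩
    have := hchar K
    rw [← map_gLam_mul (g := g) (u := u) hβ, nonunitFactor_eq_of_one_three hS hβ h1 h2]
    exact (unitFactor_eq hS hβ hχ).imp (fun h => ⟨h.1, by rw [h.2]⟩) fun h => ⟨h.1, by rw [h.2]⟩
  · have h1 : n₁ % 4 = 3 := by omega
    have h2 : n₂ % 4 = 3 := by omega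
    have hχ := χ₈_mul_χ₈_eq_one (a := n₁) (b := n₂) (by omega) (by omega) (by omega)
    rw [natDegree_unitFactor hS hβ hχ, nonunitFactor_eq_of_three_three hS hβ h1 h2,
      natDegree_X_pow_sub_one'] at hdeg
    have hk : (gLam n₁ n₂ g u).natDegree + ((n₁ + 1) * (n₂ - 1) + 2) / 2 = n₁ * n₂ := by
      rw [← hdeg, ha1, hb1, ha, show (2 * a + 1 + 1) * (2 * b) + 2 = 2 * (n₂ + a * (2 * b)) by
        rw [hb]; ring, Nat.mul_div_cancel_left _ two_pos]
    refine ⟨fun K _ _ β hβ => ?_, hasLinearSpan_wgcs hk,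
      exists_hasParameters_codeLam hk (by omega), isGeneratorPolynomial_gLam⟩
    have := hchar K
    rw [← map_gLam_mul (g := g) (u := u) hβ, nonunitFactor_eq_of_three_three hS hβ h1 h2]
    exact (unitFactor_eq hS hβ hχ).imp (fun h => ⟨h.1, by rw [h.2]⟩) fun h => ⟨h.1, by rw [h.2]⟩
  · have h1 : n₁ % 4 = 3 := by omega
    have h2 : n₂ % 4 = 1 := by omega
    have hχ := χ₈_mul_χ₈_eq_one (a := n₁) (b := n₂) (by omega) (by omega) (by omega)
    have hN := natDegree_nonunitFactor_of_three_one hS hβ h1 h2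
    rw [natDegree_unitFactor hS hβ hχ, ha1, hb1] at hdeg
    have hhalf : ((n₁ + 1) * (n₂ + 1) - 2) / 2 = n₁ + n₂ - 1 + a * (2 * b) := by
      have : (n₁ + 1) * (n₂ + 1) = 2 * (n₁ + n₂ - 1 + a * (2 * b)) + 2 := by
        rw [show n₁ + n₂ - 1 = 2 * a + 2 * b + 1 by omega, ha, hb]; ring
      omega
    have hk : (gLam n₁ n₂ g u).natDegree + ((n₁ + 1) * (n₂ + 1) - 2) / 2 = n₁ * n₂ := by
      omega
    refine ⟨fun K _ _ β hβ => ?_, hasLinearSpan_wgcs hk,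
      exists_hasParameters_codeLam hk (by omega), isGeneratorPolynomial_gLam⟩
    have := hchar K
    rw [← map_gLam_mul (g := g) (u := u) hβ, ← nonunitFactor_mul_eq_of_three_one hS hβ h1 h2]
    exact (unitFactor_eq hS hβ hχ).imp (fun h => ⟨h.1, by rw [h.2]; ring⟩)
      fun h => ⟨h.1, by rw [h.2]; ring⟩
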